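/- Let $\mathbb D$ be the open unit disc and $\mathbb B_2\subset\mathbb C^2$ the open Euclidean unit ball. Let $\mathcal D_{1/2}$ be the reproducing kernel Hilbert space on $\mathbb D$ with kernel $k(z,w)=(1-z\overline w)^{-1/2}$, and let $H^2_2$ (the Drury--Arveson space) be the reproducing kernel Hilbert space on $\mathbb B_2$ with kernel $k(z,w)=(1-\langle z,w\rangle)^{-1}$. For a reproducing kernel Hilbert space $\mathcal H$ on $X$ with kernel $k$, let $d(x,y)=\Big(1-\frac{|k(x,y)|^2}{k(x,x)k(y,y)}\Big)^{1/2}$, and let $\operatorname{Mult}(\mathcal H)$ be the algebra of functions $\varphi$ with $\varphi\mathcal H\subset\mathcal H$, with norm $\|\varphi\|_{\operatorname{Mult}(\mathcal H)}=\sup\{\|\varphi f\|:\|f\|\le 1\}$. A countable family $(x_i)_{i\in I}$ in $X$ * is *strongly separated* if there is $\varepsilon>0$ such that for every $i$ there is $\varphi\in\operatorname{Mult}(\mathcal H)$ of norm at most one with $\varphi(x_i)=\varepsilon$ and $\varphi(x_j)=0$ for all $j\ne i$; * is *uniformly separated* if $\inf_i\prod_{j\neq i}d(x_j,x_i)>0$;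 * *satisfies the Carleson condition* if there is $C\ge 0$ with $\sum_i |f(x_i)|^2/k(x_i,x_i)\le C\|f\|^2$ for all $f\in\mathcal H$; * *generates a finite measure* if $\sum_i 1/k(x_i,x_i)<\infty$, and *generates an infinite measure* otherwise. Let $(z_n)_{n\in\mathbb N}$ be a sequence in $\mathbb D$, let $z_n^{1/2}$ be any square root of $z_n$, let $N_n=\lfloor (1-|z_n|)^{-1/2}\rfloor$, and let $W$ be the family of the points $$w_{(n,j)}=2^{-1/2}z_n^{1/2}\big(e^{2\pi i j/N_n},e^{-2\pi i j/N_n}\big)\in\mathbb B_2,\qquad n\in\mathbb N,\ 0\le j\le\lfloor N_n/4\rfloor,$$ indexed by the pairs $(n,j)$. These points lie on the fibres of $r(\zeta_1,\zeta_2)=2\zeta_1\zeta_2$, that is, $r(w_{(n,j)})=z_n$, and if the $z_n$ are pairwise distinct, then so are the points $w_{(n,j)}$. Moreover: (a) If $(z_n)$ is strongly separated for $\mathcal D_{1/2}$, then $W$ is strongly separated for $H^2_2$. (b) If $(z_n)$ generates an infinite measure for $\mathcal D_{1/2}$, then $W$ generates an infinite measure for $H^2_2$. (c) If $(z_n)$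 fails the Carleson condition for $\mathcal D_{1/2}$, then $W$ fails the Carleson condition for $H^2_2$. (d) If $(z_n)$ is uniformly separated for $\mathcal D_{1/2}$, then $W$ is uniformly separated for $H^2_2$. -/

import Mathlib

open scoped ComplexConjugate ENNReal

noncomputable section

/-! ### Positivity of power series kernels -/

/-- The operator-valued version of a scalar kernel: `k x y` acts on `ℂ` by multiplication. -/
def opKernel {X : Type*} (k : Matrix X X ℂ) : Matrix X X (ℂ →L[ℂ] ℂ) :=
  .of fun x y => k x y • ContinuousLinearMap.id ℂ ℂ

section
open scoped ComplexOrder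

theorem opKernel_posSemidef {X : Type*} {k : Matrix X X ℂ} (hk : k.PosSemidef) :
    (opKernel k).PosSemidef := by
  have key := (RKHS.posSemidef_tfae (𝕜 := ℂ) (K := opKernel k)).out 0 2 rfl rfl
  refine key.mpr ⟨?_, fun vv => ?_⟩
  · ext x y
    have := hk.1.apply x y
    simp only [opKernel, Matrix.conjTranspose_apply, Matrix.of_apply, star_smul, this]
    have h1 : star (ContinuousLinearMap.id ℂ ℂ) = ContinuousLinearMap.id ℂ ℂ :=
      star_one (ℂ →L[ℂ] ℂ)
    simp [h1]
  · have h := hk.2 vv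
    have h' := (Complex.le_def.mp h).1
    simp only [Complex.zero_re] at h'
    refine h'.trans_eq ?_
    simp only [Finsupp.sum, opKernel, Matrix.of_apply, RCLike.re_to_complex, Complex.re_sum]
    refine Finset.sum_congr rfl fun x _ => Finset.sum_congr rfl fun y _ => ?_
    have := hk.1.apply x y
    rw [← this]
    simp [mul_comm]

/-- If `u` is a positive kernel and `∑ cₙ uⁿ` converges pointwise with `cₙ ≥ 0`, then the sum
is a positive kernel. -/
theorem posSemidef_of_hasSum {X : Type*} {u k : Matrix X X ℂ} (hu : u.PosSemidef)
    {c : ℕ → ℝ} (hc : ∀ n, 0 ≤ c n) (h : ∀ x y, HasSum (fun n => (c n : ℂ) * u x y ^ n) (k x y)) :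
    k.PosSemidef := by
  have hpow : ∀ n : ℕ, (Matrix.of fun x y => u x y ^ n : Matrix X X ℂ).PosSemidef := by
    intro n
    induction n with
    | zero =>
      refine ⟨by ext x y; simp, fun x => ?_⟩
      have : (x.sum fun i xi => x.sum fun j xj =>
          star xi * (Matrix.of fun x y => u x y ^ 0 : Matrix X X ℂ) i j * xj)
          = star (x.sum fun _ xi => xi) * (x.sum fun _ xi => xi) := by
        simp [Finsupp.sum, Finset.sum_mul_sum]
      rw [this]
      exact star_mul_self_nonneg _
    | succ n ih =>
      have := ih.hadamard hu
      exact this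
  refine ⟨?_, fun v => ?_⟩
  · ext x y
    have h1 := (h y x).star
    refine h1.unique ?_
    have h2 := h x y
    refine Eq.mpr (congrArg (fun f => HasSum f _) (funext fun n => ?_)) h2
    have := hu.1.apply x y
    simp [← this]
  · have hs : HasSum (fun n => (c n : ℂ) * v.sum fun i xi => v.sum fun j xj =>
        star xi * (Matrix.of fun x y => u x y ^ n : Matrix X X ℂ) i j * xj)
        (v.sum fun i xi => v.sum fun j xj => star xi * k i j * xj) := by
      simp only [Finsupp.sum, Finset.mul_sum]
      refine hasSum_sum fun i _ => hasSum_sum fun j _ => ?_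
      have := ((h i j).mul_left (star (v i))).mul_right (v j)
      refine Eq.mpr (congrArg (fun f => HasSum f _) (funext fun n => ?_)) this
      simp only [Matrix.of_apply]
      ring
    exact hs.nonneg fun n => mul_nonneg (by exact_mod_cast hc n) ((hpow n).2 v)

theorem posSemidef_inner {E : Type*} [NormedAddCommGroup E] [InnerProductSpace ℂ E] (s : Set E) :
    (Matrix.of fun x y : s => inner ℂ (y : E) (x : E) : Matrix s s ℂ).PosSemidef := by
  refine ⟨by ext x y; simp, fun v => ?_⟩
  have : (v.sum fun i xi => v.sum fun j xj =>
      star xi * (Matrix.of fun x y : s => inner ℂ (y : E) (x : E) : Matrix s s ℂ) i j * xj)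
      = inner ℂ (v.sum fun j xj => star xj • (j : E)) (v.sum fun i xi => star xi • (i : E)) := by
    simp only [Finsupp.sum, sum_inner, inner_sum, inner_smul_left, inner_smul_right,
      Finset.mul_sum]
    refine Finset.sum_congr rfl fun x _ => Finset.sum_congr rfl fun y _ => ?_
    simp [mul_comm, mul_left_comm]
  rw [this, inner_self_eq_norm_sq_to_K, RCLike.ofReal_eq_complex_ofReal, ← Complex.ofReal_pow]
  exact Complex.zero_le_real.mpr (sq_nonneg _)

theorem norm_inner_lt_one {E : Type*} [NormedAddCommGroup E] [InnerProductSpace ℂ E]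
    (x y : Metric.ball (0 : E) 1) : ‖inner ℂ (y : E) (x : E)‖ < 1 := by
  have hx := mem_ball_zero_iff.mp x.2
  have hy := mem_ball_zero_iff.mp y.2
  calc ‖inner ℂ (y : E) (x : E)‖ ≤ ‖(y : E)‖ * ‖(x : E)‖ := norm_inner_le_norm _ _
    _ < 1 := by nlinarith [norm_nonneg (x : E), norm_nonneg (y : E)]

theorem multichoose_nonneg {a : ℝ} (ha : 0 ≤ a) (n : ℕ) : 0 ≤ Ring.multichoose a n := by
  have h := Ring.factorial_nsmul_multichoose_eq_ascPochhammer a n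
  rw [Polynomial.ascPochhammer_smeval_eq_eval] at h
  have h2 : 0 ≤ (ascPochhammer ℝ n).eval a := by
    clear h
    induction n with
    | zero => simp
    | succ n ih =>
      rw [ascPochhammer_succ_eval]
      positivity
  rw [← h, nsmul_eq_mul] at h2
  exact (mul_nonneg_iff_of_pos_left (by positivity)).mp h2

theorem hasSum_one_sub_cpow (a : ℝ) {x : ℂ} (hx : ‖x‖ < 1) :
    HasSum (fun n : ℕ => ((Ring.multichoose a n : ℝ) : ℂ) * x ^ n)
      (1 / (1 - x) ^ (a : ℂ)) := by
  have h := (Complex.one_div_one_sub_cpow_hasFPowerSeriesOnBall_zero (a : ℂ)).hasSum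
    (y := x) (by simpa [← ofReal_norm] using hx)
  simp only [zero_add] at h
  refine Eq.mpr (congrArg (fun f => HasSum f _) (funext fun n => ?_)) h
  rw [FormalMultilinearSeries.ofScalars_apply_eq, Ring.multichoose_eq, smul_eq_mul,
    Complex.ofReal_choose]
  push_cast
  rfl

end

/-! ### The two spaces -/

/-- The open unit disc `𝔻`. -/
abbrev Disc : Type := Metric.ball (0 : ℂ) 1

/-- The open Euclidean unit ball `𝔹_d` of `ℂ^d`. -/
abbrev UnitBall (d : ℕ) : Type := Metric.ball (0 : EuclideanSpace ℂ (Fin d)) 1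

/-- The kernel `k_a(z, w) = 1 / (1 - z w̄)^a` (principal branch) on the disc. -/
def weightedDirichletKernel (a : ℝ) : Matrix Disc Disc ℂ :=
  .of fun z w => 1 / (1 - (z : ℂ) * conj (w : ℂ)) ^ (a : ℂ)

/-- The kernel `k(z, w) = 1 / (1 - ⟨z, w⟩)` on the ball; Mathlib's `inner` is conjugate linear in
its first argument. -/
def druryArvesonKernel (d : ℕ) : Matrix (UnitBall d) (UnitBall d) ℂ :=
  .of fun z w => 1 / (1 - inner ℂ (w : EuclideanSpace ℂ (Fin d)) (z : EuclideanSpace ℂ (Fin d)))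

open scoped ComplexOrder in
instance weightedDirichlet_fact (a : NNReal) :
    Fact (opKernel (weightedDirichletKernel a)).PosSemidef := by
  refine ⟨opKernel_posSemidef (posSemidef_of_hasSum (posSemidef_inner (Metric.ball (0 : ℂ) 1))
    (fun n => multichoose_nonneg a.2 n) fun x y => ?_)⟩
  have h := hasSum_one_sub_cpow (a : ℝ) (norm_inner_lt_one x y)
  simpa [weightedDirichletKernel] using h

open scoped ComplexOrder in
instance druryArveson_fact (d : ℕ) : Fact (opKernel (druryArvesonKernel d)).PosSemidef := by
  refine ⟨opKernel_posSemidef (posSemidef_of_hasSum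
    (posSemidef_inner (Metric.ball (0 : EuclideanSpace ℂ (Fin d)) 1))
    (c := fun _ => 1) (fun n => zero_le_one) fun x y => ?_)⟩
  have h := hasSum_geometric_of_norm_lt_one (norm_inner_lt_one x y)
  simpa [druryArvesonKernel] using h

/-- The standard weighted Dirichlet space `𝓓_a`: the reproducing kernel Hilbert space on the disc
with kernel `k_a`. -/
def WeightedDirichletSpace (a : NNReal) : Type :=
  RKHS.OfKernel (opKernel (weightedDirichletKernel a))

namespace WeightedDirichletSpace
variable (a : NNReal)

instance : NormedAddCommGroup (WeightedDirichletSpace a) :=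
  inferInstanceAs (NormedAddCommGroup (RKHS.OfKernel (opKernel (weightedDirichletKernel a))))
instance : InnerProductSpace ℂ (WeightedDirichletSpace a) :=
  inferInstanceAs (InnerProductSpace ℂ (RKHS.OfKernel (opKernel (weightedDirichletKernel a))))
instance : CompleteSpace (WeightedDirichletSpace a) :=
  inferInstanceAs (CompleteSpace (RKHS.OfKernel (opKernel (weightedDirichletKernel a))))
instance : RKHS ℂ (WeightedDirichletSpace a) Disc ℂ :=
  inferInstanceAs (RKHS ℂ (RKHS.OfKernel (opKernel (weightedDirichletKernel a))) Disc ℂ)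

theorem kernel_eq :
    RKHS.kernel (WeightedDirichletSpace a) = opKernel (weightedDirichletKernel a) :=
  RKHS.OfKernel.kernel_ofKernel

end WeightedDirichletSpace

/-- The Drury--Arveson space `H²_d`: the reproducing kernel Hilbert space on `𝔹_d` with kernel
`1 / (1 - ⟨z, w⟩)`. -/
def DruryArvesonSpace (d : ℕ) : Type :=
  RKHS.OfKernel (opKernel (druryArvesonKernel d))

namespace DruryArvesonSpace
variable (d : ℕ)

instance : NormedAddCommGroup (DruryArvesonSpace d) :=
  inferInstanceAs (NormedAddCommGroup (RKHS.OfKernel (opKernel (druryArvesonKernel d))))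
instance : InnerProductSpace ℂ (DruryArvesonSpace d) :=
  inferInstanceAs (InnerProductSpace ℂ (RKHS.OfKernel (opKernel (druryArvesonKernel d))))
instance : CompleteSpace (DruryArvesonSpace d) :=
  inferInstanceAs (CompleteSpace (RKHS.OfKernel (opKernel (druryArvesonKernel d))))
instance : RKHS ℂ (DruryArvesonSpace d) (UnitBall d) ℂ :=
  inferInstanceAs (RKHS ℂ (RKHS.OfKernel (opKernel (druryArvesonKernel d))) (UnitBall d) ℂ)

theorem kernel_eq : RKHS.kernel (DruryArvesonSpace d) = opKernel (druryArvesonKernel d) :=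
  RKHS.OfKernel.kernel_ofKernel

end DruryArvesonSpace

/-! ### Multipliers, separation, Carleson and measure conditions

`H` is a reproducing kernel Hilbert space of complex functions on `X`, and `z : ι → X` is a family
of points (a sequence when `ι` is countable). -/

section Conditions

variable {X : Type*} (H : Type*) [NormedAddCommGroup H] [InnerProductSpace ℂ H] [CompleteSpace H]
  [RKHS ℂ H X ℂ]

/-- The scalar reproducing kernel `k(x, y)` of `H`, so that `f y = ⟨f, k(·, y)⟩`. -/
def repKernel (x y : X) : ℂ := RKHS.kernel H x y 1

/-- The multipliers of `H`: the functions `φ` with `φ f ∈ H` for all `f ∈ H`. -/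
def Mult : Set (X → ℂ) := {φ | ∀ f : H, ∃ g : H, ∀ x, g x = φ x * f x}

/-- The multiplier norm `sup {‖φ f‖ : f ∈ H, ‖f‖ ≤ 1}` of a multiplier, with values in `[0, ∞]`. -/
def multNorm (φ : X → ℂ) : ℝ≥0∞ :=
  ⨆ (f : H) (g : H) (_ : ‖f‖ ≤ 1) (_ : ∀ x, g x = φ x * f x), ‖g‖ₑ

/-- `d(x, y) = √(1 - |k(x, y)|² / (k(x, x) k(y, y)))`. -/
def kernelDist (x y : X) : ℝ :=
  √(1 - ‖repKernel H x y‖ ^ 2 / ((repKernel H x x).re * (repKernel H y y).re))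

variable {ι : Type*}

/-- Strong separation: for some `ε > 0` and every `n` there is a multiplier of norm at most one
with value `ε` at `z n` and value `0` at all other `z j`. -/
def StronglySeparated (z : ι → X) : Prop :=
  ∃ ε : ℝ, 0 < ε ∧ ∀ n, ∃ φ ∈ Mult H, multNorm H φ ≤ 1 ∧ φ (z n) = ε ∧
    ∀ j, j ≠ n → φ (z j) = 0

/-- Uniform separation: `inf_n ∏_{j ≠ n} d(z_j, z_n) > 0`. All factors lie in `[0, 1]`, so the
products always converge unconditionally. -/
def UniformlySeparated (z : ι → X) : Prop :=
  ∃ ε : ℝ, 0 < ε ∧ ∀ n, ε ≤ ∏' j : {j : ι // j ≠ n}, kernelDist H (z j) (z n)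

/-- The Carleson measure condition: `∑ₙ |f(z_n)|² / k(z_n, z_n) ≤ C ‖f‖²` for all `f ∈ H`. -/
def CarlesonCondition (z : ι → X) : Prop :=
  ∃ C : ℝ, 0 ≤ C ∧ ∀ f : H,
    Summable (fun n => ‖f (z n)‖ ^ 2 / (repKernel H (z n) (z n)).re) ∧
      ∑' n, ‖f (z n)‖ ^ 2 / (repKernel H (z n) (z n)).re ≤ C * ‖f‖ ^ 2

/-- The family generates a finite measure: `∑ₙ 1 / k(z_n, z_n) < ∞`. -/
def GeneratesFiniteMeasure (z : ι → X) : Prop :=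
  Summable fun n => 1 / (repKernel H (z n) (z n)).re

end Conditions

/-! ### The points in the ball -/

/-- `N = ⌊1 / (1 - |z|)^{1/2}⌋`. -/
def fibreNumber (z : Disc) : ℕ := ⌊1 / √(1 - ‖(z : ℂ)‖)⌋₊

/-- The point `2^{-1/2} s (e^{2πij/N}, e^{-2πij/N})`. -/
def fibrePoint (s : ℂ) (N j : ℕ) : EuclideanSpace ℂ (Fin 2) :=
  ((√2 : ℝ) : ℂ)⁻¹ • s • !₂[Complex.exp (2 * Real.pi * Complex.I * j / N),
    Complex.exp (-(2 * Real.pi * Complex.I * j / N))]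

theorem norm_fibrePoint (s : ℂ) (N j : ℕ) : ‖fibrePoint s N j‖ = ‖s‖ := by
  have h1 : (2 * Real.pi * Complex.I * j / N : ℂ) = ((2 * Real.pi * j / N : ℝ) : ℂ) * Complex.I := by
    push_cast; ring
  have h2 : (-(((2 * Real.pi * j / N : ℝ) : ℂ) * Complex.I)) =
      ((-(2 * Real.pi * j / N) : ℝ) : ℂ) * Complex.I := by
    push_cast; ring
  have h3 : ‖(!₂[Complex.exp (2 * Real.pi * Complex.I * j / N),
      Complex.exp (-(2 * Real.pi * Complex.I * j / N))] : EuclideanSpace ℂ (Fin 2))‖ = √2 := by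
    rw [EuclideanSpace.norm_eq, h1, h2]
    simp only [Fin.sum_univ_two, Matrix.cons_val_zero, Matrix.cons_val_one,
      Complex.norm_exp_ofReal_mul_I]
    norm_num
  rw [fibrePoint, norm_smul, norm_smul, h3, norm_inv, Complex.norm_real, Real.norm_eq_abs,
    abs_of_nonneg (Real.sqrt_nonneg 2)]
  field_simp

/-- Index set of the points in the ball: pairs `(n, j)` with `0 ≤ j ≤ ⌊N_n / 4⌋`. -/
abbrev FibreIndex (z : ℕ → Disc) : Type := Σ n : ℕ, Fin (fibreNumber (z n) / 4 + 1)

/-- The family `w_{(n,j)} = 2^{-1/2} s_n (e^{2πij/N_n}, e^{-2πij/N_n})` in `𝔹₂`, where `s_n` is a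
square root of `z_n`. -/
def fibreFamily (z : ℕ → Disc) (s : ℕ → ℂ) (hs : ∀ n, s n ^ 2 = z n) :
    FibreIndex z → UnitBall 2 := fun p =>
  ⟨fibrePoint (s p.1) (fibreNumber (z p.1)) p.2, by
    rw [mem_ball_zero_iff, norm_fibrePoint]
    have h := mem_ball_zero_iff.mp (z p.1).2
    rw [← hs, norm_pow] at h
    exact (sq_lt_one_iff₀ (norm_nonneg _)).mp h⟩

/-- The map `r(z₁, z₂) = 2 z₁ z₂`. -/
def rMap (w : UnitBall 2) : ℂ := 2 * (w : EuclideanSpace ℂ (Fin 2)) 0 * (w : EuclideanSpace ℂ (Fin 2)) 1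

end

noncomputable section

/-! ### Positive kernels -/

section PositiveKernels
open scoped ComplexOrder

variable {X E F : Type*} [NormedAddCommGroup E] [InnerProductSpace ℂ E]
  [NormedAddCommGroup F] [InnerProductSpace ℂ F]

/-! The proof compares the two kernels along `r`. Put `u = z₁w̄₁`, `v = z₂w̄₂`, `S = √(1 - 4uv)` and
`C = 2 / (1 + S)`. The Drury–Arveson kernel `1 / (1 - u - v)` is the pulled-back kernel `1 / S`
times `F = S / (1 - u - v)`, and `F - 1 = uC / (1 - uC) + vC / (1 - vC)` is a positive kernel. Hence
`f ↦ f ∘ r` is contractive, also on multipliers of norm at most one, and the ratio `1 - d²` does not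
increase when a pair is lifted to the ball (`kernelRatio_druryArveson_le`).

The quantitative input is `fibre_sum_le`: for a fixed point of `W`, the ratios `1 - d²` summed over
one whole fibre are at most a constant times the corresponding ratio on the disc. Inner products of
points of `W` are `A cos x` with `A² = z_m z̄_n`, and the sum is a Riemann sum for an arctangent
integral.

For (d), a product of distances is bounded below once the ratios have bounded sum and stay away from
1; the fibre estimate provides the sum. For (a), the multiplier on the disc composed with `r` kills
the other fibres, and a finite product of two-point multipliers kills the rest of the given fibre.
For (b) and (c), a fibre carries about `N_n / 4` masses `1 - |z_n|`, comparable to `√(1 - |z_n|)`,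
and the contrapositives follow by summing over fibres. -/

theorem finsupp_sum_inner_eq_norm_sq (u : X → E) (c : X →₀ ℂ) :
    (c.sum fun i ci => c.sum fun j cj => star ci * inner ℂ (u i) (u j) * cj)
      = ((‖Finsupp.linearCombination ℂ u c‖ ^ 2 : ℝ) : ℂ) := by
  have h := inner_self_eq_norm_sq_to_K (𝕜 := ℂ) (Finsupp.linearCombination ℂ u c)
  rw [RCLike.ofReal_eq_complex_ofReal, ← Complex.ofReal_pow] at h
  rw [← h, Finsupp.linearCombination_apply]
  simp only [Finsupp.sum, sum_inner, inner_sum, inner_smul_left, inner_smul_right,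
    Complex.star_def, Finset.mul_sum]
  rw [Finset.sum_comm]
  refine Finset.sum_congr rfl fun i _ => Finset.sum_congr rfl fun j _ => by ring

/-- The quadratic form of the difference is `‖∑ c u‖² - ‖∑ c v‖²`. This turns kernel inequalities
into contractions and back. -/
theorem posSemidef_gram_sub_gram_iff (u : X → E) (v : X → F) :
    (Matrix.of fun x y => inner ℂ (u x) (u y) - inner ℂ (v x) (v y) : Matrix X X ℂ).PosSemidef ↔
      ∀ c : X →₀ ℂ, ‖Finsupp.linearCombination ℂ v c‖ ≤ ‖Finsupp.linearCombination ℂ u c‖ := by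
  have key : ∀ c : X →₀ ℂ, (c.sum fun i ci => c.sum fun j cj => star ci *
      (Matrix.of fun x y => inner ℂ (u x) (u y) - inner ℂ (v x) (v y) : Matrix X X ℂ) i j * cj) =
      ((‖Finsupp.linearCombination ℂ u c‖ ^ 2 - ‖Finsupp.linearCombination ℂ v c‖ ^ 2 : ℝ) : ℂ) := by
    intro c
    rw [Complex.ofReal_sub, ← finsupp_sum_inner_eq_norm_sq, ← finsupp_sum_inner_eq_norm_sq]
    simp only [Finsupp.sum, ← Finset.sum_sub_distrib, Matrix.of_apply]
    refine Finset.sum_congr rfl fun i _ => Finset.sum_congr rfl fun j _ => by ring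
  constructor
  · intro h c
    have := h.2 c
    rw [key, Complex.zero_le_real, sub_nonneg] at this
    exact (sq_le_sq₀ (norm_nonneg _) (norm_nonneg _)).mp this
  · intro h
    refine ⟨by ext x y; simp, fun c => ?_⟩
    rw [key, Complex.zero_le_real, sub_nonneg]
    exact (sq_le_sq₀ (norm_nonneg _) (norm_nonneg _)).mpr (h c)

theorem posSemidef_gram (u : X → E) :
    (Matrix.of fun x y => inner ℂ (u x) (u y) : Matrix X X ℂ).PosSemidef := by
  have := (posSemidef_gram_sub_gram_iff u (fun _ => (0 : E))).mpr fun c => by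
    simp [Finsupp.linearCombination_apply]
  simpa using this

/-- A kernel of the form `⟨u x, u y⟩`, linear in `x`, is positive. -/
theorem posSemidef_gram_swap (u : X → E) :
    (Matrix.of fun x y => inner ℂ (u y) (u x) : Matrix X X ℂ).PosSemidef := by
  have := (posSemidef_gram u).transpose
  exact this

theorem posSemidef_rank_one (g : X → ℂ) :
    (Matrix.of fun x y => g x * conj (g y) : Matrix X X ℂ).PosSemidef := by
  have := posSemidef_gram_swap g
  simpa using this

theorem Matrix.PosSemidef.of_mul {K L : X → X → ℂ} (hK : (Matrix.of K).PosSemidef)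
    (hL : (Matrix.of L).PosSemidef) : (Matrix.of fun x y => K x y * L x y).PosSemidef :=
  hK.hadamard hL

theorem Matrix.PosSemidef.of_add {K L : X → X → ℂ} (hK : (Matrix.of K).PosSemidef)
    (hL : (Matrix.of L).PosSemidef) : (Matrix.of fun x y => K x y + L x y).PosSemidef :=
  hK.add hL

/-- Nonnegativity of the 2 × 2 minor at `x, y`. -/
theorem Matrix.PosSemidef.norm_sq_le {K : Matrix X X ℂ} (hK : K.PosSemidef) (x y : X) :
    ‖K x y‖ ^ 2 ≤ (K x x).re * (K y y).re := by
  have h := (hK.submatrix ![x, y]).det_nonneg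
  rw [Matrix.det_fin_two] at h
  simp only [Matrix.submatrix_apply, Matrix.cons_val_zero, Matrix.cons_val_one] at h
  have hxx := hK.1.apply x x
  have hyy := hK.1.apply y y
  have hxy := hK.1.apply y x
  rw [← hxy, Complex.star_def, Complex.mul_conj, Complex.normSq_eq_norm_sq] at h
  have h' := (Complex.le_def.mp h).1
  have ix : (K x x).im = 0 := Complex.conj_eq_iff_im.mp hxx
  rw [Complex.sub_re, Complex.mul_re, ix, Complex.ofReal_re, Complex.zero_re] at h'
  linarith

end PositiveKernels

/-! ### Contractions and multipliers -/

theorem exists_contraction_of_gram_le {X E F : Type*}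
    [NormedAddCommGroup E] [InnerProductSpace ℂ E]
    [NormedAddCommGroup F] [InnerProductSpace ℂ F] [CompleteSpace F] {u : X → E} {v : X → F}
    (hu : DenseRange (Finsupp.linearCombination ℂ u))
    (h : ∀ c : X →₀ ℂ, ‖Finsupp.linearCombination ℂ v c‖ ≤ ‖Finsupp.linearCombination ℂ u c‖) :
    ∃ T : E →L[ℂ] F, ‖T‖ ≤ 1 ∧ ∀ x, T (u x) = v x := by
  have h1 : ∀ c : X →₀ ℂ, ‖Finsupp.linearCombination ℂ v c‖ ≤
      1 * ‖Finsupp.linearCombination ℂ u c‖ := fun c => (h c).trans_eq (one_mul _).symm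
  refine ⟨(Finsupp.linearCombination ℂ v).extendOfNorm (Finsupp.linearCombination ℂ u),
    LinearMap.opNorm_extendOfNorm_le hu zero_le_one h1, fun x => ?_⟩
  have := LinearMap.extendOfNorm_eq hu ⟨1, h1⟩ (Finsupp.single x 1)
  simpa using this

section Multipliers
open scoped ComplexOrder

variable {X : Type*} (H : Type*) [NormedAddCommGroup H] [InnerProductSpace ℂ H]
  [RKHS ℂ H X ℂ]

/-- `φ` multiplies `H` into itself without increasing the norm. -/
def ContractiveMultiplier (φ : X → ℂ) : Prop :=
  ∀ f : H, ∃ g : H, (∀ x, g x = φ x * f x) ∧ ‖g‖ ≤ ‖f‖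

variable {H} {φ ψ : X → ℂ}

theorem ContractiveMultiplier.mem_mult (hφ : ContractiveMultiplier H φ) : φ ∈ Mult H :=
  fun f => (hφ f).imp fun _ hg => hg.1

theorem ContractiveMultiplier.multNorm_le (hφ : ContractiveMultiplier H φ) :
    multNorm H φ ≤ 1 := by
  refine iSup_le fun f => iSup_le fun g => iSup_le fun hf => iSup_le fun hg => ?_
  obtain ⟨g', hg', hn⟩ := hφ f
  have : g = g' := RKHS.ext fun x => by rw [hg, hg']
  rw [this, ← ofReal_norm, ← ENNReal.ofReal_one]
  exact ENNReal.ofReal_le_ofReal (hn.trans hf)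

theorem contractiveMultiplier_of_multNorm_le (hφ : φ ∈ Mult H) (h : multNorm H φ ≤ 1) :
    ContractiveMultiplier H φ := by
  intro f
  obtain ⟨g, hg⟩ := hφ f
  refine ⟨g, hg, ?_⟩
  rcases eq_or_ne f 0 with rfl | hf
  · have : g = 0 := RKHS.ext fun x => by rw [hg]; simp
    simp [this]
  have hf' : 0 < ‖f‖ := norm_pos_iff.mpr hf
  -- The supremum only sees the unit ball, so `f` is normalised first.
  have h1 : ‖((‖f‖⁻¹ : ℝ) : ℂ) • g‖ₑ ≤ 1 := by
    refine le_trans ?_ h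
    refine le_iSup_of_le (((‖f‖⁻¹ : ℝ) : ℂ) • f) (le_iSup_of_le (((‖f‖⁻¹ : ℝ) : ℂ) • g)
      (le_iSup_of_le ?_ (le_iSup_of_le ?_ le_rfl)))
    · rw [norm_smul, Complex.norm_real, norm_inv, norm_norm, inv_mul_cancel₀ hf'.ne']
    · intro x
      simp only [RKHS.coe_smul, Pi.smul_apply, smul_eq_mul, hg]
      ring
  rw [← ofReal_norm, ← ENNReal.ofReal_one, ENNReal.ofReal_le_ofReal_iff zero_le_one,
    norm_smul, Complex.norm_real, norm_inv, norm_norm, inv_mul_le_iff₀ hf', mul_one] at h1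
  exact h1

theorem ContractiveMultiplier.one : ContractiveMultiplier H (1 : X → ℂ) :=
  fun f => ⟨f, by simp, le_rfl⟩

theorem ContractiveMultiplier.mul (hφ : ContractiveMultiplier H φ)
    (hψ : ContractiveMultiplier H ψ) : ContractiveMultiplier H (φ * ψ) := by
  intro f
  obtain ⟨g, hg, hgn⟩ := hψ f
  obtain ⟨h, hh, hhn⟩ := hφ g
  exact ⟨h, fun x => by rw [hh, hg, Pi.mul_apply, mul_assoc], hhn.trans hgn⟩

theorem ContractiveMultiplier.prod {ι : Type*} (s : Finset ι) {φ : ι → X → ℂ}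
    (h : ∀ i ∈ s, ContractiveMultiplier H (φ i)) : ContractiveMultiplier H (∏ i ∈ s, φ i) :=
  Finset.prod_induction _ _ (fun _ _ => ContractiveMultiplier.mul) ContractiveMultiplier.one h

theorem ContractiveMultiplier.smul (hφ : ContractiveMultiplier H φ) {c : ℂ} (hc : ‖c‖ ≤ 1) :
    ContractiveMultiplier H (c • φ) := by
  intro f
  obtain ⟨g, hg, hgn⟩ := hφ f
  refine ⟨c • g, fun x => by simp [hg, mul_assoc], ?_⟩
  rw [norm_smul]
  exact (mul_le_of_le_one_left (norm_nonneg _) hc).trans hgn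

/-! ### Contractive multipliers and positive kernels -/

variable (H) [CompleteSpace H]

theorem inner_kerFun_kerFun (x y : X) :
    inner ℂ (RKHS.kerFun H x 1) (RKHS.kerFun H y 1) = repKernel H x y := by
  rw [RKHS.kerFun_inner, RKHS.kerFun_apply]
  simp [repKernel]

theorem denseRange_kerFun :
    DenseRange (Finsupp.linearCombination ℂ fun x : X => RKHS.kerFun H x (1 : ℂ)) := by
  have h := RKHS.kerFun_dense (𝕜 := ℂ) H
  have h2 : Submodule.span ℂ {x | ∃ (y : X) (v : ℂ), RKHS.kerFun H y v = x} =
      LinearMap.range (Finsupp.linearCombination ℂ fun x : X => RKHS.kerFun H x (1 : ℂ)) := by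
    rw [Finsupp.range_linearCombination]
    refine le_antisymm (Submodule.span_le.mpr ?_) (Submodule.span_mono ?_)
    · rintro _ ⟨x, v, rfl⟩
      have : RKHS.kerFun H x v = v • RKHS.kerFun H x (1 : ℂ) := by simp [← map_smul]
      rw [this]
      exact Submodule.smul_mem _ _ (Submodule.subset_span ⟨x, rfl⟩)
    · rintro _ ⟨x, rfl⟩
      exact ⟨x, 1, rfl⟩
  rw [h2] at h
  have := Submodule.dense_iff_topologicalClosure_eq_top.mpr h
  exact this

theorem posSemidef_repKernel : (Matrix.of (repKernel H) : Matrix X X ℂ).PosSemidef := by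
  have := posSemidef_gram fun x : X => RKHS.kerFun H x (1 : ℂ)
  simpa only [inner_kerFun_kerFun] using this

variable {H} {φ : X → ℂ}

theorem one_sub_mul_repKernel_eq (φ : X → ℂ) :
    (Matrix.of fun x y => (1 - φ x * conj (φ y)) * repKernel H x y : Matrix X X ℂ) =
    Matrix.of fun x y => inner ℂ (RKHS.kerFun H x (1 : ℂ)) (RKHS.kerFun H y (1 : ℂ)) -
      inner ℂ (conj (φ x) • RKHS.kerFun H x (1 : ℂ)) (conj (φ y) • RKHS.kerFun H y (1 : ℂ)) := by
  ext x y
  simp only [Matrix.of_apply]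
  rw [inner_smul_left, inner_smul_right, inner_kerFun_kerFun, Complex.conj_conj]
  ring

/-- The adjoint of multiplication sends `k_x` to `conj (φ x) k_x`. No operator is needed: with `w =
∑ c k_x` and `h` its image, `‖h‖² = ⟨w, φ h⟩ ≤ ‖w‖ ‖h‖`. -/
theorem ContractiveMultiplier.posSemidef (hφ : ContractiveMultiplier H φ) :
    (Matrix.of fun x y => (1 - φ x * conj (φ y)) * repKernel H x y : Matrix X X ℂ).PosSemidef := by
  rw [one_sub_mul_repKernel_eq, posSemidef_gram_sub_gram_iff]
  intro c
  set h := Finsupp.linearCombination ℂ (fun x => conj (φ x) • RKHS.kerFun H x (1 : ℂ)) c with hh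
  set w := Finsupp.linearCombination ℂ (fun x => RKHS.kerFun H x (1 : ℂ)) c with hw
  obtain ⟨g, hg, hgn⟩ := hφ h
  have key : inner ℂ w g = inner ℂ h h := by
    have e : inner ℂ h h = inner ℂ (Finsupp.linearCombination ℂ
      (fun x => conj (φ x) • RKHS.kerFun H x (1 : ℂ)) c) h := by rw [← hh]
    rw [e, hw]
    simp only [Finsupp.linearCombination_apply, Finsupp.sum, sum_inner, inner_smul_left,
      RKHS.kerFun_inner, hg, Complex.conj_conj]
    refine Finset.sum_congr rfl fun x _ => ?_
    simp
  have h1 : ‖h‖ * ‖h‖ ≤ ‖w‖ * ‖h‖ := by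
    rw [← inner_self_eq_norm_mul_norm (𝕜 := ℂ), ← key]
    refine (RCLike.re_le_norm _).trans ((norm_inner_le_norm _ _).trans ?_)
    gcongr
  rcases (norm_nonneg h).eq_or_lt with h0 | h0
  · rw [← h0]; exact norm_nonneg _
  · exact le_of_mul_le_mul_right h1 h0

/-- Positivity makes `k_x ↦ conj (φ x) k_x` a contraction `T`; its adjoint is multiplication by `φ`.
-/
theorem contractiveMultiplier_of_posSemidef
    (h : (Matrix.of fun x y => (1 - φ x * conj (φ y)) * repKernel H x y :
      Matrix X X ℂ).PosSemidef) : ContractiveMultiplier H φ := by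
  rw [one_sub_mul_repKernel_eq, posSemidef_gram_sub_gram_iff] at h
  obtain ⟨T, hT, hTk⟩ := exists_contraction_of_gram_le (denseRange_kerFun H) h
  intro f
  refine ⟨T.adjoint f, fun x => ?_, ?_⟩
  · have h1 : inner ℂ (RKHS.kerFun H x (1 : ℂ)) (T.adjoint f) = (T.adjoint f : H) x := by
      simp [RKHS.kerFun_inner]
    rw [← h1, ContinuousLinearMap.adjoint_inner_right, hTk, inner_smul_left, RKHS.kerFun_inner]
    simp
  · refine (T.adjoint.le_opNorm f).trans (mul_le_of_le_one_left (norm_nonneg _) ?_)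
    rwa [LinearIsometryEquiv.norm_map]

/-- If `k_H - k_G ∘ r` is positive, then `f ↦ f ∘ r` is a contraction from `G` to `H`. -/
theorem exists_comp_of_posSemidef {Y : Type*} {G : Type*} [NormedAddCommGroup G]
    [InnerProductSpace ℂ G] [CompleteSpace G] [RKHS ℂ G Y ℂ] (r : X → Y)
    (h : (Matrix.of fun x y => repKernel H x y - repKernel G (r x) (r y) :
      Matrix X X ℂ).PosSemidef) (f : G) : ∃ g : H, (∀ x, g x = f (r x)) ∧ ‖g‖ ≤ ‖f‖ := by
  have h' : (Matrix.of fun x y => inner ℂ (RKHS.kerFun H x (1 : ℂ)) (RKHS.kerFun H y (1 : ℂ)) -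
      inner ℂ (RKHS.kerFun G (r x) (1 : ℂ)) (RKHS.kerFun G (r y) (1 : ℂ)) :
      Matrix X X ℂ).PosSemidef := by
    simpa only [inner_kerFun_kerFun] using h
  rw [posSemidef_gram_sub_gram_iff] at h'
  -- `T` sends `k_x` to `k_{r(x)}`, so its adjoint is composition with `r`.
  obtain ⟨T, hT, hTk⟩ := exists_contraction_of_gram_le (denseRange_kerFun H) h'
  refine ⟨T.adjoint f, fun x => ?_, ?_⟩
  · have h1 : inner ℂ (RKHS.kerFun H x (1 : ℂ)) (T.adjoint f) = (T.adjoint f : H) x := by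
      simp [RKHS.kerFun_inner]
    rw [← h1, ContinuousLinearMap.adjoint_inner_right, hTk, RKHS.kerFun_inner]
    simp
  · refine (T.adjoint.le_opNorm f).trans (mul_le_of_le_one_left (norm_nonneg _) ?_)
    rwa [LinearIsometryEquiv.norm_map]

end Multipliers

/-! ### The square root of `1 - t` -/

section SquareRoot
open scoped ComplexOrder

/-- In the rising factorial `a (a + 1) ⋯ (a + n)` only the first factor is nonpositive. -/
theorem multichoose_succ_nonpos {a : ℝ} (ha : a ≤ 0) (ha' : 0 ≤ a + 1) (n : ℕ) :
    Ring.multichoose a (n + 1) ≤ 0 := by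
  have h := Ring.factorial_nsmul_multichoose_eq_ascPochhammer a (n + 1)
  have h' := Ring.factorial_nsmul_multichoose_eq_ascPochhammer (a + 1) n
  rw [Polynomial.ascPochhammer_smeval_eq_eval] at h h'
  rw [ascPochhammer_succ_left, Polynomial.eval_mul, Polynomial.eval_X, Polynomial.eval_comp,
    Polynomial.eval_add, Polynomial.eval_X, Polynomial.eval_one, ← h', nsmul_eq_mul,
    nsmul_eq_mul] at h
  have h1 : 0 ≤ Ring.multichoose (a + 1) n := multichoose_nonneg ha' n
  have h2 : (0 : ℝ) < (n + 1).factorial := by positivity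
  have h3 : ((n + 1).factorial : ℝ) * Ring.multichoose a (n + 1) ≤ 0 := by
    rw [h]
    exact mul_nonpos_of_nonpos_of_nonneg ha (by positivity)
  nlinarith

/-- The coefficients of the power series of `1 - (1 - t)^{1/2}`. -/
def oneSubSqrtCoeff (n : ℕ) : ℝ := if n = 0 then 0 else -Ring.multichoose (-(1 / 2) : ℝ) n

theorem oneSubSqrtCoeff_nonneg (n : ℕ) : 0 ≤ oneSubSqrtCoeff n := by
  cases n with
  | zero => simp [oneSubSqrtCoeff]
  | succ n =>
    have := multichoose_succ_nonpos (a := -(1 / 2)) (by norm_num) (by norm_num) n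
    simpa [oneSubSqrtCoeff] using this

theorem hasSum_one_sub_sqrt {x : ℂ} (hx : ‖x‖ < 1) :
    HasSum (fun n => (oneSubSqrtCoeff n : ℂ) * x ^ n) (1 - (1 - x) ^ (1 / 2 : ℂ)) := by
  have h1 := hasSum_one_sub_cpow (-(1 / 2)) hx
  have h2 : HasSum (fun n : ℕ => if n = 0 then (1 : ℂ) else 0) 1 := hasSum_ite_eq 0 1
  have h3 := h2.sub h1
  have e1 : (1 : ℂ) / (1 - x) ^ (((-(1 / 2) : ℝ)) : ℂ) = (1 - x) ^ (1 / 2 : ℂ) := by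
    push_cast
    rw [Complex.cpow_neg]
    simp
  rw [e1] at h3
  refine Eq.mpr (congrArg (fun f => HasSum f _) (funext fun n => ?_)) h3
  cases n with
  | zero => simp [oneSubSqrtCoeff]
  | succ n => simp [oneSubSqrtCoeff]

theorem sqrt_re_nonneg (x : ℂ) : 0 ≤ (x ^ (1 / 2 : ℂ)).re := by
  rcases eq_or_ne x 0 with rfl | hx
  · simp
  rw [Complex.cpow_def_of_ne_zero hx, Complex.exp_re]
  refine mul_nonneg (Real.exp_pos _).le (Real.cos_nonneg_of_mem_Icc ?_)
  have h : (Complex.log x * (1 / 2)).im = x.arg / 2 := by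
    rw [show (1 / 2 : ℂ) = ((1 / 2 : ℝ) : ℂ) by push_cast; rfl, Complex.im_mul_ofReal,
      Complex.log_im]
    ring
  rw [h]
  have := Complex.arg_le_pi x
  have := Complex.neg_pi_lt_arg x
  constructor <;> linarith

theorem sqrt_sq_eq (x : ℂ) : (x ^ (1 / 2 : ℂ)) ^ 2 = x := by
  have := Complex.cpow_nat_inv_pow x (n := 2) two_ne_zero
  rwa [Nat.cast_ofNat, ← one_div] at this

theorem one_le_norm_one_add_sqrt (x : ℂ) : 1 ≤ ‖1 + x ^ (1 / 2 : ℂ)‖ := by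
  refine le_trans ?_ (Complex.re_le_norm _)
  have := sqrt_re_nonneg x
  simp only [Complex.add_re, Complex.one_re]
  linarith

theorem norm_one_sub_sqrt_le (x : ℂ) : ‖1 - (1 - x) ^ (1 / 2 : ℂ)‖ ≤ ‖x‖ := by
  have h : (1 - (1 - x) ^ (1 / 2 : ℂ)) * (1 + (1 - x) ^ (1 / 2 : ℂ)) = x := by
    have := sqrt_sq_eq (1 - x)
    linear_combination -this
  have h1 := one_le_norm_one_add_sqrt (1 - x)
  calc ‖1 - (1 - x) ^ (1 / 2 : ℂ)‖
      ≤ ‖1 - (1 - x) ^ (1 / 2 : ℂ)‖ * ‖1 + (1 - x) ^ (1 / 2 : ℂ)‖ :=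
        le_mul_of_one_le_right (norm_nonneg _) h1
    _ = ‖x‖ := by rw [← norm_mul, h]

/-- The kernel `2 / (1 + (1 - z w̄)^{1/2})` on the disc. -/
def catalanKernel (z w : Disc) : ℂ := 2 / (1 + (1 - (z : ℂ) * conj (w : ℂ)) ^ (1 / 2 : ℂ))

theorem norm_mul_conj_lt_one (z w : Disc) : ‖(z : ℂ) * conj (w : ℂ)‖ < 1 := by
  have := norm_inner_lt_one z w
  simpa using this

/-- With `S = √(1 - z w̄)`, this is the geometric series of `(1 - S) / 2`, and `1 - S` has
nonnegative Taylor coefficients. -/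
theorem posSemidef_catalanKernel : (Matrix.of catalanKernel).PosSemidef := by
  have h1 : (Matrix.of fun z w : Disc =>
      1 - (1 - (z : ℂ) * conj (w : ℂ)) ^ (1 / 2 : ℂ)).PosSemidef :=
    posSemidef_of_hasSum (posSemidef_rank_one fun z : Disc => (z : ℂ))
      oneSubSqrtCoeff_nonneg fun z w => hasSum_one_sub_sqrt (norm_mul_conj_lt_one z w)
  refine posSemidef_of_hasSum h1 (c := fun n => (1 / 2) ^ n) (fun n => by positivity) fun z w => ?_
  have h2 := (norm_one_sub_sqrt_le ((z : ℂ) * conj (w : ℂ))).trans_lt (norm_mul_conj_lt_one z w)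
  have h3 : ‖(1 / 2 : ℂ) * (1 - (1 - (z : ℂ) * conj (w : ℂ)) ^ (1 / 2 : ℂ))‖ < 1 := by
    rw [norm_mul]
    norm_num
    linarith
  have h4 := hasSum_geometric_of_norm_lt_one h3
  have h5 : (1 + (1 - (z : ℂ) * conj (w : ℂ)) ^ (1 / 2 : ℂ)) ≠ 0 := fun h => by
    have := one_le_norm_one_add_sqrt (1 - (z : ℂ) * conj (w : ℂ))
    rw [h, norm_zero] at this
    linarith
  have h6 : (1 - (1 / 2 : ℂ) * (1 - (1 - (z : ℂ) * conj (w : ℂ)) ^ (1 / 2 : ℂ)))⁻¹ =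
      Matrix.of catalanKernel z w := by
    rw [Matrix.of_apply, catalanKernel, inv_eq_one_div, div_eq_div_iff _ h5]
    · ring
    · intro h
      exact h5 (by linear_combination 2 * h)
  rw [h6] at h4
  refine Eq.mpr (congrArg (fun f => HasSum f _) (funext fun n => ?_)) h4
  simp [mul_pow]

end SquareRoot

/-! ### Comparison of the two kernels along `r` -/

section Comparison
open scoped ComplexOrder

theorem repKernel_weightedDirichlet (a : NNReal) (z w : Disc) :
    repKernel (WeightedDirichletSpace a) z w = 1 / (1 - (z : ℂ) * conj (w : ℂ)) ^ ((a : ℝ) : ℂ) := by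
  rw [repKernel, WeightedDirichletSpace.kernel_eq]
  simp [opKernel, weightedDirichletKernel]

theorem repKernel_dirichletHalf (z w : Disc) :
    repKernel (WeightedDirichletSpace (1 / 2)) z w =
      1 / (1 - (z : ℂ) * conj (w : ℂ)) ^ (1 / 2 : ℂ) := by
  rw [repKernel_weightedDirichlet]
  push_cast
  rfl

theorem repKernel_druryArveson (d : ℕ) (z w : UnitBall d) :
    repKernel (DruryArvesonSpace d) z w =
      1 / (1 - inner ℂ (w : EuclideanSpace ℂ (Fin d)) (z : EuclideanSpace ℂ (Fin d))) := by
  rw [repKernel, DruryArvesonSpace.kernel_eq]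
  simp [opKernel, druryArvesonKernel]

theorem inner_ball_two (z w : EuclideanSpace ℂ (Fin 2)) :
    inner ℂ w z = z 0 * conj (w 0) + z 1 * conj (w 1) := by
  rw [PiLp.inner_apply, Fin.sum_univ_two]
  simp

theorem norm_sq_coord_sum_lt_one (w : UnitBall 2) :
    ‖(w : EuclideanSpace ℂ (Fin 2)) 0‖ ^ 2 + ‖(w : EuclideanSpace ℂ (Fin 2)) 1‖ ^ 2 < 1 := by
  have h := mem_ball_zero_iff.mp w.2
  have h2 := EuclideanSpace.norm_sq_eq (w : EuclideanSpace ℂ (Fin 2))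
  rw [Fin.sum_univ_two] at h2
  rw [← h2]
  exact (sq_lt_one_iff₀ (norm_nonneg _)).mpr h

/-- The map `r` as a map into the disc. -/
def rDisc (w : UnitBall 2) : Disc := ⟨rMap w, by
  rw [mem_ball_zero_iff, rMap, norm_mul, norm_mul, Complex.norm_ofNat]
  nlinarith [norm_sq_coord_sum_lt_one w, sq_nonneg (‖(w : EuclideanSpace ℂ (Fin 2)) 0‖ -
    ‖(w : EuclideanSpace ℂ (Fin 2)) 1‖)]⟩

theorem coe_rDisc_mul_conj (z w : UnitBall 2) :
    (rDisc z : ℂ) * conj (rDisc w : ℂ) =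
      4 * ((z : EuclideanSpace ℂ (Fin 2)) 0 * conj ((w : EuclideanSpace ℂ (Fin 2)) 0)) *
        ((z : EuclideanSpace ℂ (Fin 2)) 1 * conj ((w : EuclideanSpace ℂ (Fin 2)) 1)) := by
  simp only [rDisc, rMap, map_mul, Complex.conj_ofNat]
  ring

/-- The kernel `(z, w) ↦ zᵢ w̄ᵢ C(r(z), r(w))` on the ball, `C` the Catalan kernel. -/
def coordCatalanKernel (i : Fin 2) (z w : UnitBall 2) : ℂ :=
  (z : EuclideanSpace ℂ (Fin 2)) i * conj ((w : EuclideanSpace ℂ (Fin 2)) i) *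
    catalanKernel (rDisc z) (rDisc w)

theorem posSemidef_coordCatalanKernel (i : Fin 2) :
    (Matrix.of (coordCatalanKernel i)).PosSemidef :=
  (posSemidef_rank_one fun z : UnitBall 2 => (z : EuclideanSpace ℂ (Fin 2)) i).of_mul
    (posSemidef_catalanKernel.submatrix rDisc)

/-- Since `(p - q)² = (p + q)² - 4pq ≤ 1 - 4pq`, adding `p + q < 1` to `p - q ≤ √(1 - 4pq)`
suffices. -/
theorem two_mul_lt_one_add_sqrt {p q : ℝ} (hp : 0 ≤ p) (hq : 0 ≤ q) (h : p + q < 1) :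
    2 * p < 1 + √(1 - 4 * p * q) := by
  have h1 : p - q ≤ √(1 - 4 * p * q) := Real.le_sqrt_of_sq_le (by nlinarith)
  linarith

theorem coordCatalanKernel_self_re_lt_one (i : Fin 2) (z : UnitBall 2) :
    (coordCatalanKernel i z z).re < 1 := by
  have key : ∀ p q : ℝ, 0 ≤ p → 0 ≤ q → p + q < 1 →
      (p * (2 / (1 + (1 - 4 * (p : ℂ) * q) ^ (1 / 2 : ℂ)))).re < 1 := by
    intro p q hp hq hpq
    have h0 : 0 ≤ 1 - 4 * p * q := by nlinarith [sq_nonneg (p - q)]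
    have e : (1 - 4 * (p : ℂ) * q) ^ (1 / 2 : ℂ) = ((√(1 - 4 * p * q) : ℝ) : ℂ) := by
      rw [Real.sqrt_eq_rpow, Complex.ofReal_cpow h0]
      push_cast
      rfl
    rw [e, show (p * (2 / (1 + ((√(1 - 4 * p * q) : ℝ) : ℂ)))) =
      ((p * (2 / (1 + √(1 - 4 * p * q))) : ℝ) : ℂ) by push_cast; rfl, Complex.ofReal_re,
      mul_div_assoc', div_lt_one (by positivity)]
    linarith [two_mul_lt_one_add_sqrt hp hq hpq]
  have hs := norm_sq_coord_sum_lt_one z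
  have e : ∀ j, (z : EuclideanSpace ℂ (Fin 2)) j * conj ((z : EuclideanSpace ℂ (Fin 2)) j) =
      ((‖(z : EuclideanSpace ℂ (Fin 2)) j‖ ^ 2 : ℝ) : ℂ) := fun j => by
    rw [Complex.mul_conj, Complex.normSq_eq_norm_sq]
  rw [coordCatalanKernel, catalanKernel, coe_rDisc_mul_conj, e, e, e]
  fin_cases i
  · exact key _ _ (by positivity) (by positivity) hs
  · have := key _ _ (sq_nonneg ‖(z : EuclideanSpace ℂ (Fin 2)) 1‖)
      (sq_nonneg ‖(z : EuclideanSpace ℂ (Fin 2)) 0‖) (by linarith)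
    rwa [mul_right_comm (4 : ℂ)] at this

/-- Cauchy–Schwarz for positive kernels carries the bound from the diagonal to all pairs. -/
theorem norm_coordCatalanKernel_lt_one (i : Fin 2) (z w : UnitBall 2) :
    ‖coordCatalanKernel i z w‖ < 1 := by
  have h := (posSemidef_coordCatalanKernel i).norm_sq_le z w
  have h1 := coordCatalanKernel_self_re_lt_one i z
  have h2 := coordCatalanKernel_self_re_lt_one i w
  have h3 : 0 ≤ (coordCatalanKernel i z z).re :=
    (Complex.le_def.mp ((posSemidef_coordCatalanKernel i).diag_nonneg (i := z))).1
  have h4 : 0 ≤ (coordCatalanKernel i w w).re :=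
    (Complex.le_def.mp ((posSemidef_coordCatalanKernel i).diag_nonneg (i := w))).1
  simp only [Matrix.of_apply] at h
  rw [← sq_lt_one_iff₀ (norm_nonneg _)]
  nlinarith

/-- If `P` is a positive kernel bounded by one in modulus, then so is `P / (1 - P)`. -/
theorem posSemidef_div_one_sub {X : Type*} {P : X → X → ℂ} (hP : (Matrix.of P).PosSemidef)
    (h : ∀ x y, ‖P x y‖ < 1) : (Matrix.of fun x y => P x y / (1 - P x y)).PosSemidef := by
  have h1 : (Matrix.of fun x y => (1 - P x y)⁻¹).PosSemidef :=
    posSemidef_of_hasSum hP (c := fun _ => 1) (fun _ => zero_le_one) fun x y => by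
      simpa using hasSum_geometric_of_norm_lt_one (h x y)
  simpa only [div_eq_mul_inv] using hP.of_mul h1

/-- The quotient of the Drury--Arveson kernel by the pullback of the `𝓓_{1/2}` kernel. -/
def kernelQuotient (z w : UnitBall 2) : ℂ :=
  (1 - (rDisc z : ℂ) * conj (rDisc w : ℂ)) ^ (1 / 2 : ℂ) *
    repKernel (DruryArvesonSpace 2) z w

theorem one_sub_inner_ne_zero {d : ℕ} (z w : UnitBall d) :
    1 - inner ℂ (w : EuclideanSpace ℂ (Fin d)) (z : EuclideanSpace ℂ (Fin d)) ≠ 0 := by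
  intro h
  have := norm_inner_lt_one z w
  rw [← sub_eq_zero.mp h, norm_one] at this
  exact lt_irrefl _ this

/-- After clearing denominators everything rests on `S² = 1 - 4uv`, which gives `(1 + S - 2u)(1 + S
- 2v) = 2(1 + S)(1 - u - v)`. -/
theorem kernelQuotient_sub_one (z w : UnitBall 2) :
    kernelQuotient z w - 1 = coordCatalanKernel 0 z w / (1 - coordCatalanKernel 0 z w) +
      coordCatalanKernel 1 z w / (1 - coordCatalanKernel 1 z w) := by
  have hu : 1 - coordCatalanKernel 0 z w ≠ 0 := fun h => by
    have := norm_coordCatalanKernel_lt_one 0 z w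
    rw [← sub_eq_zero.mp h, norm_one] at this
    exact lt_irrefl _ this
  have hv : 1 - coordCatalanKernel 1 z w ≠ 0 := fun h => by
    have := norm_coordCatalanKernel_lt_one 1 z w
    rw [← sub_eq_zero.mp h, norm_one] at this
    exact lt_irrefl _ this
  have hd := one_sub_inner_ne_zero z w
  rw [kernelQuotient, repKernel_druryArveson]
  rw [inner_ball_two] at hd ⊢
  rw [coordCatalanKernel] at hu hv
  rw [coordCatalanKernel, coordCatalanKernel]
  rw [catalanKernel, coe_rDisc_mul_conj] at *
  set u := (z : EuclideanSpace ℂ (Fin 2)) 0 * conj ((w : EuclideanSpace ℂ (Fin 2)) 0)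
  set v := (z : EuclideanSpace ℂ (Fin 2)) 1 * conj ((w : EuclideanSpace ℂ (Fin 2)) 1)
  have hS := sqrt_sq_eq (1 - 4 * u * v)
  have h1 : 1 + (1 - 4 * u * v) ^ (1 / 2 : ℂ) ≠ 0 := fun h => by
    have := one_le_norm_one_add_sqrt (1 - 4 * u * v)
    rw [h, norm_zero] at this
    linarith
  set S := (1 - 4 * u * v) ^ (1 / 2 : ℂ)
  have hu' : 1 + S - u * 2 ≠ 0 := fun h => hu (by field_simp; rw [h, mul_zero])
  have hv' : 1 + S - v * 2 ≠ 0 := fun h => hv (by field_simp; rw [h, mul_zero])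
  have e1 : u * (2 / (1 + S)) / (1 - u * (2 / (1 + S))) = u * 2 / (1 + S - u * 2) := by
    field_simp
  have e2 : v * (2 / (1 + S)) / (1 - v * (2 / (1 + S))) = v * 2 / (1 + S - v * 2) := by
    field_simp
  have e3 : (1 + S - u * 2) * (1 + S - v * 2) = 2 * (1 + S) * (1 - (u + v)) := by
    linear_combination hS
  rw [e1, e2, div_add_div _ _ hu' hv', e3, eq_div_iff (by simp [h1, hd])]
  field_simp
  linear_combination hS

theorem posSemidef_kernelQuotient_sub_one :
    (Matrix.of fun z w => kernelQuotient z w - 1).PosSemidef := by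
  simp only [kernelQuotient_sub_one]
  exact (posSemidef_div_one_sub (posSemidef_coordCatalanKernel 0)
    (norm_coordCatalanKernel_lt_one 0)).of_add (posSemidef_div_one_sub
    (posSemidef_coordCatalanKernel 1) (norm_coordCatalanKernel_lt_one 1))

theorem posSemidef_kernelQuotient : (Matrix.of kernelQuotient).PosSemidef := by
  have h : (Matrix.of fun _ _ : UnitBall 2 => (1 : ℂ)).PosSemidef := by
    simpa using posSemidef_rank_one fun _ : UnitBall 2 => (1 : ℂ)
  have := posSemidef_kernelQuotient_sub_one.of_add h
  simpa only [sub_add_cancel] using this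

theorem repKernel_druryArveson_eq_mul (z w : UnitBall 2) :
    repKernel (DruryArvesonSpace 2) z w =
      repKernel (WeightedDirichletSpace (1 / 2)) (rDisc z) (rDisc w) * kernelQuotient z w := by
  have h : (1 - (rDisc z : ℂ) * conj (rDisc w : ℂ)) ^ (1 / 2 : ℂ) ≠ 0 := fun h => by
    have h1 := sqrt_sq_eq (1 - (rDisc z : ℂ) * conj (rDisc w : ℂ))
    have h2 := norm_mul_conj_lt_one (rDisc z) (rDisc w)
    rw [h, zero_pow two_ne_zero, eq_comm, sub_eq_zero] at h1
    rw [← h1, norm_one] at h2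
    exact lt_irrefl _ h2
  rw [repKernel_dirichletHalf, kernelQuotient]
  field_simp

theorem exists_comp_rDisc (f : WeightedDirichletSpace (1 / 2)) :
    ∃ g : DruryArvesonSpace 2, (∀ w, g w = f (rDisc w)) ∧ ‖g‖ ≤ ‖f‖ := by
  refine exists_comp_of_posSemidef rDisc ?_ f
  have h := ((posSemidef_repKernel (WeightedDirichletSpace (1 / 2))).submatrix rDisc).of_mul
    posSemidef_kernelQuotient_sub_one
  refine (congrArg Matrix.PosSemidef ?_).mp h
  ext z w
  simp only [Matrix.of_apply, repKernel_druryArveson_eq_mul]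
  ring

/-- The Schur product of the pulled-back kernel `(1 - φ φ̄) k` with the positive quotient kernel is
the required kernel on the ball. -/
theorem ContractiveMultiplier.comp_rDisc {φ : Disc → ℂ}
    (h : ContractiveMultiplier (WeightedDirichletSpace (1 / 2)) φ) :
    ContractiveMultiplier (DruryArvesonSpace 2) (φ ∘ rDisc) := by
  refine contractiveMultiplier_of_posSemidef ?_
  have h := (h.posSemidef.submatrix rDisc).of_mul posSemidef_kernelQuotient
  refine (congrArg Matrix.PosSemidef ?_).mp h
  ext z w
  simp only [Matrix.of_apply, repKernel_druryArveson_eq_mul,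
    Function.comp_apply]
  ring

end Comparison

/-! ### Two-point multipliers of the Drury--Arveson space -/

section TwoPoint
open scoped ComplexOrder

/-- The Gram kernel of the feature vectors projected onto the orthogonal complement of the one at
`b`. -/
theorem Matrix.PosSemidef.sub_rank_one {X : Type*} {K : Matrix X X ℂ} (hK : K.PosSemidef)
    (b : X) : (Matrix.of fun x y => K x y - K x b * K b y / K b b : Matrix X X ℂ).PosSemidef := by
  have : Fact (opKernel K).PosSemidef := ⟨opKernel_posSemidef hK⟩
  set u : X → RKHS.OfKernel (opKernel K) := fun x => RKHS.kerFun _ x (1 : ℂ) with hu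
  have h : ∀ x y, inner ℂ (u x) (u y) = K x y := fun x y => by
    rw [hu, inner_kerFun_kerFun, repKernel, RKHS.OfKernel.kernel_ofKernel]
    simp [opKernel]
  have hKs : ∀ x y, conj (K x y) = K y x := fun x y => hK.1.apply y x
  refine (congrArg Matrix.PosSemidef ?_).mp
    (_root_.posSemidef_gram fun x => u x - (K b x / K b b) • u b)
  ext x y
  simp only [Matrix.of_apply, inner_sub_left, inner_sub_right, inner_smul_left, inner_smul_right,
    h, map_div₀, hKs]
  rcases eq_or_ne (K b b) 0 with h0 | h0
  · simp [h0]
  · field_simp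
    ring

/-- This is the kernel `⟨φ_a(z), φ_a(w)⟩` of the ball automorphism `φ_a` vanishing at `a`, written
as an explicit sum of Gram kernels times a rank-one kernel. -/
theorem posSemidef_one_sub_kernel_quotient {d : ℕ} (a : UnitBall d) :
    (Matrix.of fun z w => 1 - repKernel (DruryArvesonSpace d) z a *
      repKernel (DruryArvesonSpace d) a w / (repKernel (DruryArvesonSpace d) a a *
        repKernel (DruryArvesonSpace d) z w)).PosSemidef := by
  set p : UnitBall d → ℂ := fun z => repKernel (DruryArvesonSpace d) z a with hp
  have hr : 0 ≤ 1 - ‖(a : EuclideanSpace ℂ (Fin d))‖ ^ 2 := by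
    have := mem_ball_zero_iff.mp a.2
    nlinarith [norm_nonneg (a : EuclideanSpace ℂ (Fin d))]
  have h1 := posSemidef_gram_swap fun z : UnitBall d =>
    ((√(1 - ‖(a : EuclideanSpace ℂ (Fin d))‖ ^ 2) : ℝ) : ℂ) •
      ((z : EuclideanSpace ℂ (Fin d)) - (a : EuclideanSpace ℂ (Fin d)))
  have h2 := posSemidef_rank_one fun z : UnitBall d =>
    inner ℂ (a : EuclideanSpace ℂ (Fin d)) ((z : EuclideanSpace ℂ (Fin d)) - a)
  refine (congrArg Matrix.PosSemidef ?_).mp ((h1.of_add h2).of_mul (posSemidef_rank_one p))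
  ext z w
  have e1 := one_sub_inner_ne_zero z w
  have e2 := one_sub_inner_ne_zero z a
  have e3 := one_sub_inner_ne_zero a w
  have e4 := one_sub_inner_ne_zero a a
  have e5 : ((√(1 - ‖(a : EuclideanSpace ℂ (Fin d))‖ ^ 2) : ℝ) : ℂ) *
      ((√(1 - ‖(a : EuclideanSpace ℂ (Fin d))‖ ^ 2) : ℝ) : ℂ) =
      1 - inner ℂ (a : EuclideanSpace ℂ (Fin d)) a := by
    rw [← Complex.ofReal_mul, Real.mul_self_sqrt hr, inner_self_eq_norm_sq_to_K]
    push_cast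
    rfl
  simp only [hp, Matrix.of_apply, repKernel_druryArveson, inner_smul_left, inner_smul_right,
    inner_sub_left, inner_sub_right, map_div₀, map_sub, map_one, inner_conj_symm,
    Complex.conj_ofReal]
  have e6 : ∀ x y : ℂ, ((√(1 - ‖(a : EuclideanSpace ℂ (Fin d))‖ ^ 2) : ℝ) : ℂ) *
      (((√(1 - ‖(a : EuclideanSpace ℂ (Fin d))‖ ^ 2) : ℝ) : ℂ) * x -
        ((√(1 - ‖(a : EuclideanSpace ℂ (Fin d))‖ ^ 2) : ℝ) : ℂ) * y) =
      (1 - inner ℂ (a : EuclideanSpace ℂ (Fin d)) a) * (x - y) := fun x y => by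
    rw [← e5]
    ring
  rw [e6]
  field_simp
  ring

/-! ### Kernel ratios in a general space -/

section Ratio

variable {X : Type*} (H : Type*) [NormedAddCommGroup H] [InnerProductSpace ℂ H] [CompleteSpace H]
  [RKHS ℂ H X ℂ]

/-- The ratio `|k(x, y)|² / (k(x, x) k(y, y))`, that is, `1 - d(x, y)²`. -/
def kernelRatio (x y : X) : ℝ :=
  ‖repKernel H x y‖ ^ 2 / ((repKernel H x x).re * (repKernel H y y).re)

theorem kernelDist_eq (x y : X) :
    kernelDist H x y = √(1 - kernelRatio H x y) := rfl

theorem kernelRatio_nonneg (x y : X) :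
    0 ≤ kernelRatio H x y :=
  div_nonneg (sq_nonneg _) ((sq_nonneg _).trans ((posSemidef_repKernel H).norm_sq_le x y))

theorem kernelRatio_le_one (x y : X) :
    kernelRatio H x y ≤ 1 := by
  have h := (posSemidef_repKernel H).norm_sq_le x y
  exact div_le_one_of_le₀ h ((sq_nonneg _).trans h)

theorem conj_repKernel (x y : X) :
    conj (repKernel H x y) = repKernel H y x :=
  (posSemidef_repKernel H).1.apply y x

theorem repKernel_self_eq_re (x : X) :
    repKernel H x x = ((repKernel H x x).re : ℂ) :=
  (Complex.conj_eq_iff_re.mp (conj_repKernel H x x)).symm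

end Ratio

/-- Take the component of the automorphism `φ_a` in the direction of `φ_a(b)`; in terms of `G =
⟨φ_a, φ_a⟩` it is `G(z, b) / √G(b, b)`. -/
theorem exists_twoPoint_multiplier {d : ℕ} (a b : UnitBall d) :
    ∃ ψ : UnitBall d → ℂ, ContractiveMultiplier (DruryArvesonSpace d) ψ ∧ ψ a = 0 ∧
      ψ b = kernelDist (DruryArvesonSpace d) a b := by
  set k := repKernel (DruryArvesonSpace d) with hk
  set G : UnitBall d → UnitBall d → ℂ := fun z w => 1 - k z a * k a w / (k a a * k z w) with hG
  have hGp : (Matrix.of G).PosSemidef := posSemidef_one_sub_kernel_quotient a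
  have hk0 : ∀ z w, k z w ≠ 0 := fun z w => by
    rw [hk, repKernel_druryArveson]
    exact one_div_ne_zero (one_sub_inner_ne_zero z w)
  have hconj : ∀ z w, conj (k z w) = k w z := conj_repKernel _
  have hkr : ∀ z, k z z = ((k z z).re : ℂ) := repKernel_self_eq_re _
  have hkpos : 0 ≤ (k a a).re :=
    (Complex.le_def.mp ((posSemidef_repKernel (DruryArvesonSpace d)).diag_nonneg (i := a))).1
  have hGconj : ∀ z w, conj (G z w) = G w z := fun z w => hGp.1.apply w z
  have hGb : G b b = ((1 - ‖k a b‖ ^ 2 / ((k a a).re * (k b b).re) : ℝ) : ℂ) := by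
    have : k b a * k a b = ((‖k a b‖ ^ 2 : ℝ) : ℂ) := by
      rw [← hconj a b, mul_comm, Complex.mul_conj, Complex.normSq_eq_norm_sq]
    simp only [hG]
    rw [this, hkr a, hkr b]
    push_cast
    rfl
  set g : ℝ := 1 - ‖k a b‖ ^ 2 / ((k a a).re * (k b b).re)
  have hg0 : 0 ≤ g := sub_nonneg.mpr (kernelRatio_le_one _ a b)
  have hsq : ((√g : ℝ) : ℂ) * ((√g : ℝ) : ℂ) = g := by
    rw [← Complex.ofReal_mul, Real.mul_self_sqrt hg0]
  refine ⟨fun z => G z b / (√g : ℝ), contractiveMultiplier_of_posSemidef ?_, ?_, ?_⟩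
  · have h1 := (hGp.sub_rank_one b).of_mul (posSemidef_repKernel (DruryArvesonSpace d))
    have h2 := posSemidef_rank_one fun z => k z a / (√(k a a).re : ℝ)
    refine (congrArg Matrix.PosSemidef ?_).mp (h1.of_add h2)
    ext z w
    have e1 : G z b / (√g : ℝ) * conj (G w b / (√g : ℝ)) = G z b * G b w / G b b := by
      rw [map_div₀, Complex.conj_ofReal, hGconj, div_mul_div_comm, hsq, hGb]
    have e2 : k z a / (√(k a a).re : ℝ) * conj (k w a / (√(k a a).re : ℝ)) =
        k z a * k a w / k a a := by
      rw [map_div₀, Complex.conj_ofReal, hconj, div_mul_div_comm, ← Complex.ofReal_mul,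
        Real.mul_self_sqrt hkpos, ← hkr]
    have e3 : (1 - G z w) * k z w = k z a * k a w / k a a := by
      have := hk0 z w
      have := hk0 a a
      simp only [hG]
      field_simp
      ring
    simp only [Matrix.of_apply]
    rw [e1, e2, ← e3]
    ring
  · have := hk0 a a
    have := hk0 a b
    simp only [hG]
    rw [div_self (mul_ne_zero ‹_› ‹_›), sub_self, zero_div]
  · have : kernelDist (DruryArvesonSpace d) a b = √g := rfl
    rw [this]
    show G b b / _ = _
    rw [hGb, ← hsq]
    -- If the distance is zero, division by zero makes `ψ` vanish, which is the required value.
    rcases eq_or_ne ((√g : ℝ) : ℂ) 0 with h0 | h0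
    · simp [h0]
    · field_simp

end TwoPoint

/-! ### Summation along a fibre -/

section FibreSum

/-- By the mean value theorem one compares with `1 / (1 + c²)`, where `|c - t| ≤ 18`. Then `c² ≤ 2t²
+ 2 · 18²`, and `649 = 1 + 2 · 18²`. -/
theorem step_div_le_arctan_sub {t h : ℝ} (h0 : 0 < h) (h1 : h ≤ 18) :
    h / (1 + t ^ 2) ≤ 649 * (Real.arctan (t + h) - Real.arctan t) := by
  obtain ⟨c, hc, hc'⟩ := exists_deriv_eq_slope Real.arctan (a := t) (b := t + h) (by linarith)
    Real.continuous_arctan.continuousOn Real.differentiable_arctan.differentiableOn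
  rw [Real.deriv_arctan, add_sub_cancel_left, eq_div_iff h0.ne'] at hc'
  rw [← hc', div_le_iff₀ (by positivity)]
  have h2 : 1 + c ^ 2 ≤ 649 * (1 + t ^ 2) := by
    have h3 : (c - t) ^ 2 ≤ 18 ^ 2 :=
      pow_le_pow_left₀ (by linarith [hc.1]) (by linarith [hc.2]) 2
    nlinarith [sq_nonneg (c - 2 * t)]
  have h4 : 1 ≤ 649 * (1 + t ^ 2) * (1 / (1 + c ^ 2)) := by
    rw [mul_one_div, le_div_iff₀ (by positivity)]
    linarith
  nlinarith

theorem sum_step_div_le (t : ℝ) {h : ℝ} (h0 : 0 < h) (h1 : h ≤ 18) (n : ℕ) :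
    ∑ k ∈ Finset.range n, h / (1 + (t + k * h) ^ 2) ≤ 649 * Real.pi := by
  calc ∑ k ∈ Finset.range n, h / (1 + (t + k * h) ^ 2)
      ≤ ∑ k ∈ Finset.range n, 649 * (Real.arctan (t + (k + 1 : ℕ) * h) -
          Real.arctan (t + k * h)) := by
        refine Finset.sum_le_sum fun k _ => (step_div_le_arctan_sub h0 h1).trans_eq ?_
        push_cast
        ring_nf
    _ = 649 * (Real.arctan (t + n * h) - Real.arctan (t + (0 : ℕ) * h)) := by
        rw [← Finset.mul_sum, Finset.sum_range_sub (fun k : ℕ => Real.arctan (t + k * h))]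
    _ ≤ 649 * Real.pi := by
        refine mul_le_mul_of_nonneg_left ?_ (by norm_num)
        exact (sub_le_sub (Real.arctan_lt_pi_div_two _).le
          (Real.neg_pi_div_two_lt_arctan _).le).trans_eq (by ring)

/-- In `1 - Ac = (1 - c) + c(1 - A)` the cross term of the squared modulus is nonnegative because
`Re A ≤ 1`. -/
theorem norm_one_sub_mul_sq_ge {A : ℂ} (hA : ‖A‖ < 1) {c : ℝ} (hc0 : 0 ≤ c) (hc1 : c ≤ 1) :
    ((1 - c) + c * ‖1 - A‖) ^ 2 / 2 ≤ ‖1 - A * c‖ ^ 2 := by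
  have hre : A.re ≤ 1 := (Complex.re_le_norm A).trans hA.le
  have e1 : ‖1 - A * c‖ ^ 2 = (1 - c * A.re) ^ 2 + (c * A.im) ^ 2 := by
    rw [← Complex.normSq_eq_norm_sq, Complex.normSq_apply]
    simp
    ring
  have e2 : ‖1 - A‖ ^ 2 = (1 - A.re) ^ 2 + A.im ^ 2 := by
    rw [← Complex.normSq_eq_norm_sq, Complex.normSq_apply]
    simp
    ring
  have e3 : ‖1 - A * c‖ ^ 2 = (1 - c) ^ 2 + (c * ‖1 - A‖) ^ 2 + 2 * ((1 - c) * (c * (1 - A.re))) := by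
    rw [e1, mul_pow c ‖1 - A‖, e2]
    ring
  have : 0 ≤ (1 - c) * (c * (1 - A.re)) :=
    mul_nonneg (by linarith) (mul_nonneg hc0 (by linarith))
  nlinarith [sq_nonneg ((1 - c) - c * ‖1 - A‖)]

theorem one_sub_cos_ge {x : ℝ} (hx : |x| ≤ Real.pi / 2) : x ^ 2 / 5 ≤ 1 - Real.cos x := by
  have h := Real.cos_le_one_sub_mul_cos_sq (x := x) (by linarith [Real.pi_pos])
  have h2 : 1 / 5 ≤ 2 / Real.pi ^ 2 := by
    rw [div_le_div_iff₀ (by norm_num) (by positivity)]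
    nlinarith [Real.pi_lt_d2, Real.pi_pos]
  nlinarith [sq_nonneg x]

/-- Angles up to `π / 2` keep the cosine nonnegative. One factor `ρ + x²` is weakened to `ρ = |1 -
A|`, leaving a summand of arctangent type. -/
theorem norm_one_sub_mul_cos_sq_ge {A : ℂ} (hA : ‖A‖ < 1) {x : ℝ} (hx : |x| ≤ Real.pi / 2) :
    ‖1 - A‖ * (‖1 - A‖ + x ^ 2) / 200 ≤ ‖1 - A * (Real.cos x : ℝ)‖ ^ 2 := by
  have hc0 : 0 ≤ Real.cos x := Real.cos_nonneg_of_mem_Icc ⟨by linarith [(abs_le.mp hx).1],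
    (abs_le.mp hx).2⟩
  have hc1 := Real.cos_le_one x
  refine le_trans ?_ (norm_one_sub_mul_sq_ge hA hc0 hc1)
  have hρ : ‖1 - A‖ ≤ 2 := by
    have := norm_sub_le 1 A
    rw [norm_one] at this
    linarith
  have h1 := one_sub_cos_ge hx
  have h0 := norm_nonneg (1 - A)
  set ρ := ‖1 - A‖
  set c := Real.cos x
  have h2 : (ρ + x ^ 2) / 10 ≤ (1 - c) + c * ρ := by nlinarith [sq_nonneg x]
  have h3 : ((ρ + x ^ 2) / 10) ^ 2 ≤ ((1 - c) + c * ρ) ^ 2 :=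
    pow_le_pow_left₀ (by positivity) h2 2
  nlinarith [sq_nonneg x]

/-- The kernel masses along a fibre are controlled by the mass of the base point. -/
theorem fibre_sum_le {α β : ℝ} (hα0 : 0 ≤ α) (hα : α < 1) (hβ0 : 0 ≤ β) (hβ : β < 1) {A : ℂ}
    (hA : ‖A‖ ^ 2 = α * β) {N : ℕ} (hN1 : N * √(1 - α) ≤ 1) (hN2 : 1 ≤ 2 * (N * √(1 - α)))
    {φ : ℝ} {n : ℕ} (hφ : ∀ k < n, |2 * Real.pi * k / N - φ| ≤ Real.pi / 2) :
    ∑ k ∈ Finset.range n, (1 - α) * (1 - β) /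
        ‖1 - A * (Real.cos (2 * Real.pi * k / N - φ) : ℝ)‖ ^ 2 ≤
      200000 * (√(1 - α ^ 2) * √(1 - β ^ 2) / ‖1 - A ^ 2‖) := by
  have hA1 : ‖A‖ < 1 := by
    rw [← sq_lt_one_iff₀ (norm_nonneg _), hA]
    nlinarith
  have hρA : 1 - ‖A‖ ≤ ‖1 - A‖ := by
    have := norm_sub_norm_le 1 A
    rwa [norm_one] at this
  have hA1' := norm_nonneg A
  -- `|A|² = αβ ≤ α` gives `1 - α ≤ 1 - |A|² ≤ 2(1 - |A|)`. The number 1.4143 below is an upper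
  -- bound for `√2`.
  have hρα : 1 - α ≤ 2 * ‖1 - A‖ := by nlinarith
  have hρβ : 1 - β ≤ 2 * ‖1 - A‖ := by nlinarith
  have hρ0 : 0 < ‖1 - A‖ := by linarith
  have hA2 : ‖1 - A ^ 2‖ ≤ 2 * ‖1 - A‖ := by
    have h1 : 1 - A ^ 2 = (1 + A) * (1 - A) := by ring
    rw [h1, norm_mul]
    have := norm_add_le 1 A
    rw [norm_one] at this
    gcongr
    linarith
  have hA20 : 0 < ‖1 - A ^ 2‖ := by
    have := norm_sub_norm_le 1 (A ^ 2)
    rw [norm_one, norm_pow] at this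
    nlinarith
  set ρ := ‖1 - A‖
  set r := √ρ
  have hr0 : 0 < r := Real.sqrt_pos.mpr hρ0
  have hrr : r ^ 2 = ρ := Real.sq_sqrt hρ0.le
  set a := √(1 - α)
  set b := √(1 - β)
  have ha0 : 0 < a := Real.sqrt_pos.mpr (by linarith)
  have hb0 : 0 < b := Real.sqrt_pos.mpr (by linarith)
  have haa : a ^ 2 = 1 - α := Real.sq_sqrt (by linarith)
  have hbb : b ^ 2 = 1 - β := Real.sq_sqrt (by linarith)
  have har : a ≤ 1.4143 * r := by
    refine le_of_sq_le_sq ?_ (by positivity)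
    nlinarith
  have hbr : b ≤ 1.4143 * r := by
    refine le_of_sq_le_sq ?_ (by positivity)
    nlinarith
  have hN0 : (0 : ℝ) < N := by
    by_contra h
    have : (N : ℝ) = 0 := le_antisymm (not_lt.mp h) (Nat.cast_nonneg N)
    rw [this] at hN2
    norm_num at hN2
  -- The angular step in units of `r = √ρ`; it is at most `4π√2 < 18`.
  set h := 2 * Real.pi / N / r with hh
  have hh0 : 0 < h := by positivity
  have hh1 : h ≤ 18 := by
    rw [hh, div_div, div_le_iff₀ (by positivity)]
    have : 1 ≤ 2 * (N * (1.4143 * r)) := hN2.trans (by gcongr)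
    nlinarith [Real.pi_lt_d2]
  have hterm : ∀ k ∈ Finset.range n, (1 - α) * (1 - β) /
      ‖1 - A * (Real.cos (2 * Real.pi * k / N - φ) : ℝ)‖ ^ 2 ≤
      (200 * a ^ 2 * b ^ 2 / (ρ ^ 2 * h)) * (h / (1 + (-φ / r + k * h) ^ 2)) := by
    intro k hk
    have h1 := norm_one_sub_mul_cos_sq_ge hA1 (hφ k (Finset.mem_range.mp hk))
    have e1 : 2 * Real.pi * k / N - φ = r * (-φ / r + k * h) := by
      rw [hh]
      field_simp
      ring
    have h2 : 0 < ρ * (ρ + (2 * Real.pi * k / N - φ) ^ 2) / 200 := by positivity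
    refine (div_le_div_of_nonneg_left (by nlinarith) h2 h1).trans_eq ?_
    rw [e1, mul_pow, hrr, haa, hbb]
    field_simp
  refine (Finset.sum_le_sum hterm).trans ?_
  rw [← Finset.mul_sum]
  have h3 : 200 * a ^ 2 * b ^ 2 / (ρ ^ 2 * h) * (649 * Real.pi) =
      64900 * (a * b / ρ) * ((N * a) * (b / r)) := by
    rw [hh, ← hrr]
    field_simp
    ring
  have h4 : (N * a) * (b / r) ≤ 1 * 1.4143 := by
    gcongr
    rwa [div_le_iff₀ hr0]
  have h5 : a * b / (2 * ρ) ≤ √(1 - α ^ 2) * √(1 - β ^ 2) / ‖1 - A ^ 2‖ := by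
    have ha : a ≤ √(1 - α ^ 2) := Real.sqrt_le_sqrt (by nlinarith)
    have hb : b ≤ √(1 - β ^ 2) := Real.sqrt_le_sqrt (by nlinarith)
    gcongr
  calc _ ≤ 200 * a ^ 2 * b ^ 2 / (ρ ^ 2 * h) * (649 * Real.pi) := by
        gcongr
        exact sum_step_div_le _ hh0 hh1 n
    _ = 64900 * (a * b / ρ) * ((N * a) * (b / r)) := h3
    _ ≤ 64900 * (a * b / ρ) * (1 * 1.4143) := by gcongr
    -- `2 · 64900 · 1.4143 < 200000`.
    _ ≤ 200000 * (a * b / (2 * ρ)) := by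
        have : 0 < a * b / ρ := by positivity
        rw [show a * b / (2 * ρ) = a * b / ρ / 2 by field_simp]
        linarith
    _ ≤ _ := by gcongr

end FibreSum

/-! ### Products of numbers close to one -/

section Products

/-- Factorwise, `√(1 - b) ≥ 1 - b ≥ exp(-b / (1 - b)) ≥ exp(-b / η)`. -/
theorem exp_neg_le_prod_sqrt {ι : Type*} (s : Finset ι) {b : ι → ℝ} {η B : ℝ} (hη : 0 < η)
    (hb0 : ∀ i ∈ s, 0 ≤ b i) (hb : ∀ i ∈ s, b i ≤ 1 - η) (hB : ∑ i ∈ s, b i ≤ B) :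
    Real.exp (-(B / η)) ≤ ∏ i ∈ s, √(1 - b i) := by
  have h : ∀ i ∈ s, Real.exp (-(b i / η)) ≤ √(1 - b i) := by
    intro i hi
    have h1 : η ≤ 1 - b i := by linarith [hb i hi]
    have h2 : 1 - b i ≤ √(1 - b i) := Real.le_sqrt_of_sq_le (by nlinarith [hb0 i hi])
    refine le_trans ?_ h2
    rw [Real.exp_neg, inv_le_comm₀ (Real.exp_pos _) (by linarith)]
    refine le_trans ?_ (Real.add_one_le_exp _)
    have h3 : (1 - b i)⁻¹ = b i / (1 - b i) + 1 := by
      have : 1 - b i ≠ 0 := by linarith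
      field_simp
      ring
    rw [h3]
    gcongr
    exact hb0 i hi
  calc Real.exp (-(B / η)) ≤ Real.exp (∑ i ∈ s, -(b i / η)) := by
        rw [Finset.sum_neg_distrib, ← Finset.sum_div]
        gcongr
    _ = ∏ i ∈ s, Real.exp (-(b i / η)) := Real.exp_sum _ _
    _ ≤ _ := Finset.prod_le_prod (fun _ _ => (Real.exp_pos _).le) h

theorem sum_le_log_of_le_prod_sqrt {ι : Type*} (s : Finset ι) {a : ι → ℝ} {ε : ℝ} (hε : 0 < ε)
    (h : ε ≤ ∏ i ∈ s, √(1 - a i)) : ∑ i ∈ s, a i ≤ -(2 * Real.log ε) := by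
  have h1 : ∏ i ∈ s, √(1 - a i) ≤ Real.exp (-(∑ i ∈ s, a i) / 2) := by
    rw [← Finset.sum_neg_distrib, Finset.sum_div, Real.exp_sum]
    refine Finset.prod_le_prod (fun _ _ => Real.sqrt_nonneg _) fun i _ => ?_
    rw [Real.exp_half]
    refine Real.sqrt_le_sqrt ?_
    linarith [Real.add_one_le_exp (-a i)]
  have h2 := (Real.log_le_iff_le_exp hε).mpr (h.trans h1)
  linarith

/-- Finite subproducts decrease along inclusion, so infinite products may be tested on finite sets.
-/
theorem hasProd_iInf_of_mem_unitInterval {ι : Type*} {x : ι → ℝ} (h0 : ∀ i, 0 ≤ x i)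
    (h1 : ∀ i, x i ≤ 1) : HasProd x (⨅ s : Finset ι, ∏ i ∈ s, x i) := by
  refine tendsto_atTop_ciInf (fun s t hst => ?_) ⟨0, ?_⟩
  · exact Finset.prod_le_prod_of_subset_of_le_one hst (fun i _ => h0 i) fun i _ _ => h1 i
  · rintro _ ⟨s, rfl⟩
    exact Finset.prod_nonneg fun i _ => h0 i

theorem le_tprod_iff_of_mem_unitInterval {ι : Type*} {x : ι → ℝ} (h0 : ∀ i, 0 ≤ x i)
    (h1 : ∀ i, x i ≤ 1) {ε : ℝ} : ε ≤ ∏' i, x i ↔ ∀ s : Finset ι, ε ≤ ∏ i ∈ s, x i := by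
  rw [(hasProd_iInf_of_mem_unitInterval h0 h1).tprod_eq]
  refine le_ciInf_iff ⟨0, ?_⟩
  rintro _ ⟨s, rfl⟩
  exact Finset.prod_nonneg fun i _ => h0 i

end Products

/-! ### Kernel ratios of the two spaces -/

section Ratios
open scoped ComplexOrder

theorem repKernel_dirichletHalf_self_re (z : Disc) :
    (repKernel (WeightedDirichletSpace (1 / 2)) z z).re = 1 / √(1 - ‖(z : ℂ)‖ ^ 2) := by
  have hz : 0 ≤ 1 - ‖(z : ℂ)‖ ^ 2 := by
    have := mem_ball_zero_iff.mp z.2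
    nlinarith [norm_nonneg (z : ℂ)]
  have e : 1 / (1 - (z : ℂ) * conj (z : ℂ)) ^ (1 / 2 : ℂ) =
      ((1 / √(1 - ‖(z : ℂ)‖ ^ 2) : ℝ) : ℂ) := by
    rw [Real.sqrt_eq_rpow, Complex.ofReal_div, Complex.ofReal_cpow hz, Complex.mul_conj,
      Complex.normSq_eq_norm_sq]
    push_cast
    rfl
  rw [repKernel_dirichletHalf, e, Complex.ofReal_re]

theorem kernelRatio_dirichletHalf (z w : Disc) :
    kernelRatio (WeightedDirichletSpace (1 / 2)) z w =
      √(1 - ‖(z : ℂ)‖ ^ 2) * √(1 - ‖(w : ℂ)‖ ^ 2) / ‖1 - (z : ℂ) * conj (w : ℂ)‖ := by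
  have h : ‖(1 - (z : ℂ) * conj (w : ℂ)) ^ (1 / 2 : ℂ)‖ ^ 2 = ‖1 - (z : ℂ) * conj (w : ℂ)‖ := by
    rw [← norm_pow, sqrt_sq_eq]
  rw [kernelRatio, repKernel_dirichletHalf_self_re, repKernel_dirichletHalf_self_re,
    repKernel_dirichletHalf, norm_div, div_pow, h, norm_one]
  field_simp

theorem repKernel_druryArveson_self_re {d : ℕ} (w : UnitBall d) :
    (repKernel (DruryArvesonSpace d) w w).re =
      1 / (1 - ‖(w : EuclideanSpace ℂ (Fin d))‖ ^ 2) := by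
  have e : 1 / (1 - inner ℂ (w : EuclideanSpace ℂ (Fin d)) (w : EuclideanSpace ℂ (Fin d))) =
      ((1 / (1 - ‖(w : EuclideanSpace ℂ (Fin d))‖ ^ 2) : ℝ) : ℂ) := by
    rw [inner_self_eq_norm_sq_to_K]
    push_cast
    rfl
  rw [repKernel_druryArveson, e, Complex.ofReal_re]

theorem kernelRatio_druryArveson {d : ℕ} (z w : UnitBall d) :
    kernelRatio (DruryArvesonSpace d) z w =
      (1 - ‖(z : EuclideanSpace ℂ (Fin d))‖ ^ 2) * (1 - ‖(w : EuclideanSpace ℂ (Fin d))‖ ^ 2) /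
        ‖1 - inner ℂ (w : EuclideanSpace ℂ (Fin d)) (z : EuclideanSpace ℂ (Fin d))‖ ^ 2 := by
  rw [kernelRatio, repKernel_druryArveson_self_re, repKernel_druryArveson_self_re,
    repKernel_druryArveson, norm_div, div_pow, norm_one]
  field_simp

theorem repKernel_druryArveson_self_re_pos {d : ℕ} (w : UnitBall d) :
    0 < (repKernel (DruryArvesonSpace d) w w).re := by
  rw [repKernel_druryArveson_self_re]
  have := mem_ball_zero_iff.mp w.2
  exact one_div_pos.mpr (by nlinarith [norm_nonneg (w : EuclideanSpace ℂ (Fin d))])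

theorem kernelRatio_druryArveson_self {d : ℕ} (w : UnitBall d) :
    kernelRatio (DruryArvesonSpace d) w w = 1 := by
  have h := repKernel_druryArveson_self_re_pos w
  have e : ‖repKernel (DruryArvesonSpace d) w w‖ = (repKernel (DruryArvesonSpace d) w w).re := by
    rw [repKernel_self_eq_re, Complex.norm_real, Complex.ofReal_re, Real.norm_of_nonneg h.le]
  rw [kernelRatio, e, sq, div_self (mul_pos h h).ne']

/-- The ratio factors, and the factor from the positive quotient kernel is at most 1 by
Cauchy–Schwarz. -/
theorem kernelRatio_druryArveson_le (z w : UnitBall 2) :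
    kernelRatio (DruryArvesonSpace 2) z w ≤
      kernelRatio (WeightedDirichletSpace (1 / 2)) (rDisc z) (rDisc w) := by
  have hre : ∀ z, (repKernel (DruryArvesonSpace 2) z z).re =
      (repKernel (WeightedDirichletSpace (1 / 2)) (rDisc z) (rDisc z)).re *
        (kernelQuotient z z).re := fun z => by
    rw [repKernel_druryArveson_eq_mul, repKernel_self_eq_re, Complex.re_ofReal_mul,
      Complex.ofReal_re]
  have hd : ∀ z, 0 ≤ (repKernel (WeightedDirichletSpace (1 / 2)) z z).re := fun z => by
    rw [repKernel_dirichletHalf_self_re]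
    positivity
  have hF : ∀ z, 0 ≤ (kernelQuotient z z).re := fun z =>
    (Complex.le_def.mp (posSemidef_kernelQuotient.diag_nonneg (i := z))).1
  have hpos : ∀ z, 0 < (repKernel (WeightedDirichletSpace (1 / 2)) (rDisc z) (rDisc z)).re ∧
      0 < (kernelQuotient z z).re := fun z => by
    have h := repKernel_druryArveson_self_re_pos z
    rw [hre] at h
    exact ⟨pos_of_mul_pos_left h (hF z), pos_of_mul_pos_right h (hd _)⟩
  obtain ⟨h1, h2⟩ := hpos z
  obtain ⟨h3, h4⟩ := hpos w
  have h5 := posSemidef_kernelQuotient.norm_sq_le z w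
  simp only [Matrix.of_apply] at h5
  rw [kernelRatio, kernelRatio, hre, hre, repKernel_druryArveson_eq_mul, norm_mul, mul_pow,
    div_le_div_iff₀ (by positivity) (by positivity)]
  calc _ ≤ ‖repKernel (WeightedDirichletSpace (1 / 2)) (rDisc z) (rDisc w)‖ ^ 2 *
        ((kernelQuotient z z).re * (kernelQuotient w w).re) *
        ((repKernel (WeightedDirichletSpace (1 / 2)) (rDisc z) (rDisc z)).re *
          (repKernel (WeightedDirichletSpace (1 / 2)) (rDisc w) (rDisc w)).re) := by gcongr
    _ = _ := by ring

end Ratios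

/-! ### The fibre family -/

section FibreFamily

theorem fibreNumber_mul_sqrt_le (z : Disc) : fibreNumber z * √(1 - ‖(z : ℂ)‖) ≤ 1 := by
  have hz := mem_ball_zero_iff.mp z.2
  have h0 : 0 < √(1 - ‖(z : ℂ)‖) := Real.sqrt_pos.mpr (by linarith)
  rw [← le_div_iff₀ h0]
  exact Nat.floor_le (by positivity)

theorem one_le_two_mul_fibreNumber_mul_sqrt (z : Disc) :
    1 ≤ 2 * (fibreNumber z * √(1 - ‖(z : ℂ)‖)) := by
  have hz := mem_ball_zero_iff.mp z.2
  have h0 : 0 < √(1 - ‖(z : ℂ)‖) := Real.sqrt_pos.mpr (by linarith)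
  have h1 : √(1 - ‖(z : ℂ)‖) ≤ 1 := Real.sqrt_le_one.mpr (by linarith [norm_nonneg (z : ℂ)])
  have h2 : 1 ≤ fibreNumber z := (Nat.one_le_floor_iff _).mpr ((one_le_div h0).mpr h1)
  have h3 : (1 : ℝ) ≤ fibreNumber z := by exact_mod_cast h2
  have h4 : 1 / √(1 - ‖(z : ℂ)‖) ≤ fibreNumber z + 1 := (Nat.lt_floor_add_one _).le
  rw [div_le_iff₀ h0] at h4
  nlinarith

theorem fibreNumber_pos (z : Disc) : (0 : ℝ) < fibreNumber z := by
  have h := one_le_two_mul_fibreNumber_mul_sqrt z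
  by_contra h0
  have : (fibreNumber z : ℝ) = 0 := le_antisymm (not_lt.mp h0) (Nat.cast_nonneg _)
  rw [this] at h
  norm_num at h

theorem fibreAngle_mem (z : Disc) {k : ℕ} (hk : k < fibreNumber z / 4 + 1) :
    0 ≤ 2 * Real.pi * k / fibreNumber z ∧ 2 * Real.pi * k / fibreNumber z ≤ Real.pi / 2 := by
  have h0 := fibreNumber_pos z
  refine ⟨by positivity, ?_⟩
  have h1 : 4 * k ≤ fibreNumber z := by omega
  have h2 : (4 * k : ℝ) ≤ fibreNumber z := by exact_mod_cast h1
  rw [div_le_iff₀ h0]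
  nlinarith [Real.pi_pos]

theorem inner_fibrePoint (s t : ℂ) (N M k j : ℕ) :
    inner ℂ (fibrePoint t M j) (fibrePoint s N k) =
      s * conj t * (Real.cos (2 * Real.pi * k / N - 2 * Real.pi * j / M) : ℝ) := by
  have h1 : ∀ N j : ℕ, (2 * Real.pi * Complex.I * j / N : ℂ) =
      ((2 * Real.pi * j / N : ℝ) : ℂ) * Complex.I := fun N j => by
    push_cast
    ring
  have h2 : ((√2 : ℝ) : ℂ) * ((√2 : ℝ) : ℂ) = 2 := by
    rw [← Complex.ofReal_mul, Real.mul_self_sqrt (by norm_num)]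
    norm_num
  have h3 : ((√2 : ℝ) : ℂ)⁻¹ * ((√2 : ℝ) : ℂ)⁻¹ = 2⁻¹ := by rw [← mul_inv, h2]
  have hc : ∀ x : ℝ, conj (Complex.exp (x * Complex.I)) = Complex.exp (-(x * Complex.I)) := by
    intro x
    rw [← Complex.exp_conj]
    simp
  have hc' : ∀ x : ℝ, conj (Complex.exp (-(x * Complex.I))) = Complex.exp (x * Complex.I) := by
    intro x
    rw [← hc, Complex.conj_conj]
  rw [inner_ball_two, fibrePoint, fibrePoint, h1, h1]
  set x : ℝ := 2 * Real.pi * k / N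
  set y : ℝ := 2 * Real.pi * j / M
  simp only [PiLp.smul_apply, smul_eq_mul, Matrix.cons_val_zero, Matrix.cons_val_one, map_mul,
    map_inv₀, Complex.conj_ofReal, hc, hc']
  rw [Complex.ofReal_cos, Complex.cos, Complex.ofReal_sub, sub_mul, neg_mul, sub_mul,
    neg_sub, sub_eq_add_neg, sub_eq_add_neg, Complex.exp_add, Complex.exp_add]
  linear_combination (s * conj t * (Complex.exp (x * Complex.I) * Complex.exp (-(y * Complex.I)) +
    Complex.exp (y * Complex.I) * Complex.exp (-(x * Complex.I)))) * h3

/-! ### Kernel ratios of the lifted points -/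

variable (z : ℕ → Disc) (s : ℕ → ℂ) (hs : ∀ n, s n ^ 2 = z n)

theorem norm_sq_eq_of_sq_eq {s w : ℂ} (h : s ^ 2 = w) : ‖s‖ ^ 2 = ‖w‖ := by
  rw [← norm_pow, h]

theorem rMap_fibreFamily (p : FibreIndex z) : rMap (fibreFamily z s hs p) = z p.1 := by
  have h2 : ((√2 : ℝ) : ℂ) * ((√2 : ℝ) : ℂ) = 2 := by
    rw [← Complex.ofReal_mul, Real.mul_self_sqrt (by norm_num)]
    norm_num
  have h3 : 2 * (((√2 : ℝ) : ℂ)⁻¹ * ((√2 : ℝ) : ℂ)⁻¹) = 1 := by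
    rw [← mul_inv, h2]
    norm_num
  rw [← hs, rMap]
  show 2 * fibrePoint _ _ _ 0 * fibrePoint _ _ _ 1 = _
  simp only [fibrePoint, PiLp.smul_apply, smul_eq_mul, Matrix.cons_val_zero, Matrix.cons_val_one,
    Complex.exp_neg]
  have := Complex.exp_ne_zero (2 * Real.pi * Complex.I * (p.2 : ℕ) / fibreNumber (z p.1))
  set E := Complex.exp (2 * Real.pi * Complex.I * (p.2 : ℕ) / fibreNumber (z p.1))
  have h4 : E * E⁻¹ = 1 := mul_inv_cancel₀ this
  linear_combination (s p.1 ^ 2) * h3 + (s p.1 ^ 2) * 2 * (((√2 : ℝ) : ℂ)⁻¹ * ((√2 : ℝ) : ℂ)⁻¹) * h4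

theorem rDisc_fibreFamily (p : FibreIndex z) : rDisc (fibreFamily z s hs p) = z p.1 :=
  Subtype.ext (rMap_fibreFamily z s hs p)

theorem norm_sq_fibreFamily (p : FibreIndex z) :
    ‖(fibreFamily z s hs p : EuclideanSpace ℂ (Fin 2))‖ ^ 2 = ‖(z p.1 : ℂ)‖ := by
  show ‖fibrePoint _ _ _‖ ^ 2 = _
  rw [norm_fibrePoint, norm_sq_eq_of_sq_eq (hs _)]

theorem kernelRatio_fibreFamily (p q : FibreIndex z) :
    kernelRatio (DruryArvesonSpace 2) (fibreFamily z s hs p) (fibreFamily z s hs q) =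
      (1 - ‖(z p.1 : ℂ)‖) * (1 - ‖(z q.1 : ℂ)‖) /
        ‖1 - s p.1 * conj (s q.1) * (Real.cos (2 * Real.pi * (p.2 : ℕ) / fibreNumber (z p.1) -
          2 * Real.pi * (q.2 : ℕ) / fibreNumber (z q.1)) : ℝ)‖ ^ 2 := by
  rw [kernelRatio_druryArveson, norm_sq_fibreFamily, norm_sq_fibreFamily, ← inner_fibrePoint]
  rfl

/-- The fibre estimate for `A = s_m s̄_n`: both angles lie in `[0, π / 2]`, and `1 - A² = 1 - z_m
z̄_n` is the denominator of the ratio on the disc. -/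
theorem sum_kernelRatio_fibre_le (m : ℕ) (q : FibreIndex z) :
    ∑ k, kernelRatio (DruryArvesonSpace 2) (fibreFamily z s hs ⟨m, k⟩) (fibreFamily z s hs q) ≤
      200000 * kernelRatio (WeightedDirichletSpace (1 / 2)) (z m) (z q.1) := by
  have hA : ‖s m * conj (s q.1)‖ ^ 2 = ‖(z m : ℂ)‖ * ‖(z q.1 : ℂ)‖ := by
    rw [norm_mul, mul_pow, Complex.norm_conj, norm_sq_eq_of_sq_eq (hs _),
      norm_sq_eq_of_sq_eq (hs _)]
  have hA2 : (s m * conj (s q.1)) ^ 2 = (z m : ℂ) * conj (z q.1 : ℂ) := by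
    rw [mul_pow, ← map_pow, hs, hs]
  have hφ : ∀ k < fibreNumber (z m) / 4 + 1, |2 * Real.pi * k / fibreNumber (z m) -
      2 * Real.pi * (q.2 : ℕ) / fibreNumber (z q.1)| ≤ Real.pi / 2 := by
    intro k hk
    have h1 := fibreAngle_mem (z m) hk
    have h2 := fibreAngle_mem (z q.1) q.2.2
    rw [abs_le]
    constructor <;> linarith
  have h := fibre_sum_le (norm_nonneg _) (mem_ball_zero_iff.mp (z m).2) (norm_nonneg _)
    (mem_ball_zero_iff.mp (z q.1).2) hA (fibreNumber_mul_sqrt_le (z m))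
    (one_le_two_mul_fibreNumber_mul_sqrt (z m)) hφ
  rw [hA2, ← kernelRatio_dirichletHalf] at h
  refine le_trans (le_of_eq ?_) h
  simp only [kernelRatio_fibreFamily]
  exact Fin.sum_univ_eq_sum_range (fun k : ℕ => (1 - ‖(z m : ℂ)‖) * (1 - ‖(z q.1 : ℂ)‖) /
        ‖1 - s m * conj (s q.1) * (Real.cos (2 * Real.pi * k / fibreNumber (z m) -
          2 * Real.pi * (q.2 : ℕ) / fibreNumber (z q.1)) : ℝ)‖ ^ 2) _

/-- Two distinct indices force `N ≥ 4`, hence `|z_n| ≥ 15/16`. The angles differ by at least `2π /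
N`, and `N²(1 - |z_n|) ≤ 1`, so `1 - |z_n| cos x ≥ 2(1 - |z_n|)`. -/
theorem kernelRatio_same_fibre_le {n : ℕ} {k j : Fin (fibreNumber (z n) / 4 + 1)} (hkj : k ≠ j) :
    kernelRatio (DruryArvesonSpace 2) (fibreFamily z s hs ⟨n, k⟩) (fibreFamily z s hs ⟨n, j⟩) ≤
      1 / 4 := by
  rw [kernelRatio_fibreFamily]
  have hz := mem_ball_zero_iff.mp (z n).2
  have hz0 := norm_nonneg (z n : ℂ)
  have hN1 := fibreNumber_mul_sqrt_le (z n)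
  have hN0 := fibreNumber_pos (z n)
  have hN4 : 4 ≤ fibreNumber (z n) := by
    have := k.2
    have := j.2
    have : (k : ℕ) ≠ j := fun h => hkj (Fin.ext h)
    omega
  have hN4' : (4 : ℝ) ≤ fibreNumber (z n) := by exact_mod_cast hN4
  have ha0 : 0 ≤ √(1 - ‖(z n : ℂ)‖) := Real.sqrt_nonneg _
  have haa : √(1 - ‖(z n : ℂ)‖) ^ 2 = 1 - ‖(z n : ℂ)‖ := Real.sq_sqrt (by linarith)
  have hNα : (fibreNumber (z n) : ℝ) ^ 2 * (1 - ‖(z n : ℂ)‖) ≤ 1 := by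
    rw [← haa, ← mul_pow]
    exact pow_le_one₀ (by positivity) hN1
  have hα : 15 / 16 ≤ ‖(z n : ℂ)‖ := by nlinarith
  have hA : s n * conj (s n) = ((‖(z n : ℂ)‖ : ℝ) : ℂ) := by
    rw [Complex.mul_conj, Complex.normSq_eq_norm_sq, norm_sq_eq_of_sq_eq (hs _)]
  have h1 := fibreAngle_mem (z n) k.2
  have h2 := fibreAngle_mem (z n) j.2
  have hx : |2 * Real.pi * (k : ℕ) / fibreNumber (z n) -
      2 * Real.pi * (j : ℕ) / fibreNumber (z n)| ≤ Real.pi / 2 := by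
    rw [abs_le]
    constructor <;> linarith
  have hcos := one_sub_cos_ge hx
  have hx2 : 36 * (1 - ‖(z n : ℂ)‖) ≤ (2 * Real.pi * (k : ℕ) / fibreNumber (z n) -
      2 * Real.pi * (j : ℕ) / fibreNumber (z n)) ^ 2 := by
    have e : 2 * Real.pi * (k : ℕ) / fibreNumber (z n) - 2 * Real.pi * (j : ℕ) /
        fibreNumber (z n) = 2 * Real.pi * (((k : ℕ) : ℝ) - (j : ℕ)) / fibreNumber (z n) := by ring
    have h3 : (1 : ℝ) ≤ (((k : ℕ) : ℝ) - (j : ℕ)) ^ 2 := by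
      have h4 : (1 : ℤ) ≤ (((k : ℕ) : ℤ) - (j : ℕ)) ^ 2 := by
        have : ((k : ℕ) : ℤ) - (j : ℕ) ≠ 0 := fun h => hkj (Fin.ext (by omega))
        have := sq_pos_of_ne_zero this
        omega
      exact_mod_cast h4
    rw [e, div_pow, le_div_iff₀ (by positivity), mul_pow, mul_pow]
    have h5 : (9 : ℝ) ≤ Real.pi ^ 2 := by nlinarith [Real.pi_gt_three]
    nlinarith
  simp only [hA]
  set c := Real.cos (2 * Real.pi * (k : ℕ) / fibreNumber (z n) -
      2 * Real.pi * (j : ℕ) / fibreNumber (z n))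
  rw [show (1 : ℂ) - ((‖(z n : ℂ)‖ : ℝ) : ℂ) * (c : ℝ) = ((1 - ‖(z n : ℂ)‖ * c : ℝ) : ℂ) by
    push_cast; rfl, Complex.norm_real, Real.norm_eq_abs, sq_abs]
  have h6 : 2 * (1 - ‖(z n : ℂ)‖) ≤ 1 - ‖(z n : ℂ)‖ * c := by nlinarith
  have h7 : 0 < 1 - ‖(z n : ℂ)‖ := by linarith
  rw [div_le_iff₀ (by nlinarith)]
  nlinarith

theorem fibreFamily_injective (hz : Function.Injective z) :
    Function.Injective (fibreFamily z s hs) := by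
  rintro ⟨n, k⟩ ⟨m, j⟩ h
  have h1 : z n = z m := by
    rw [← rDisc_fibreFamily z s hs ⟨n, k⟩, h, rDisc_fibreFamily]
  obtain rfl := hz h1
  by_contra hne
  have hkj : k ≠ j := fun h => hne (by rw [h])
  have h2 := kernelRatio_same_fibre_le z s hs hkj
  rw [h, kernelRatio_druryArveson_self] at h2
  norm_num at h2

theorem exp_neg_le_prod_kernelDist_fibre (p : FibreIndex z) :
    Real.exp (-(200000 / (3 / 4))) ≤ ∏ k ∈ Finset.univ.erase p.2,
      kernelDist (DruryArvesonSpace 2) (fibreFamily z s hs ⟨p.1, k⟩) (fibreFamily z s hs p) := by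
  simp only [kernelDist_eq]
  refine exp_neg_le_prod_sqrt _ (by norm_num) (fun k _ => kernelRatio_nonneg _ _ _)
    (fun k hk => ?_) ?_
  · have := kernelRatio_same_fibre_le z s hs (Finset.ne_of_mem_erase hk)
    refine this.trans (by norm_num)
  · refine (Finset.sum_le_sum_of_subset_of_nonneg (Finset.erase_subset _ _)
      fun _ _ _ => kernelRatio_nonneg _ _ _).trans ((sum_kernelRatio_fibre_le z s hs p.1 p).trans ?_)
    have := kernelRatio_le_one (WeightedDirichletSpace (1 / 2)) (z p.1) (z p.1)
    linarith

/-- The lifted multiplier separates fibres, two-point multipliers separate points inside the fibre.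
The product of their values is bounded below uniformly in the fibre. -/
theorem stronglySeparated_fibreFamily
    (h : StronglySeparated (WeightedDirichletSpace (1 / 2)) z) :
    StronglySeparated (DruryArvesonSpace 2) (fibreFamily z s hs) := by
  obtain ⟨ε, hε, h⟩ := h
  have hδ := Real.exp_pos (-(200000 / (3 / 4)))
  set δ := Real.exp (-(200000 / (3 / 4)))
  refine ⟨ε * δ, by positivity, fun p => ?_⟩
  obtain ⟨φ, hφ, hφ1, hφp, hφ0⟩ := h p.1
  choose ψ hψ hψa hψb using fun k => exists_twoPoint_multiplier
    (fibreFamily z s hs ⟨p.1, k⟩) (fibreFamily z s hs p)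
  have hle := exp_neg_le_prod_kernelDist_fibre z s hs p
  set P := ∏ k ∈ Finset.univ.erase p.2,
      kernelDist (DruryArvesonSpace 2) (fibreFamily z s hs ⟨p.1, k⟩) (fibreFamily z s hs p)
  have hP : 0 < P := hδ.trans_le hle
  -- The factor `δ / P ≤ 1` makes the value at the chosen point exactly `εδ`, independent of that
  -- point.
  have hm : ContractiveMultiplier (DruryArvesonSpace 2)
      (((δ / P : ℝ) : ℂ) • ((φ ∘ rDisc) * ∏ k ∈ Finset.univ.erase p.2, ψ k)) := by
    refine ContractiveMultiplier.smul (((contractiveMultiplier_of_multNorm_le hφ hφ1).comp_rDisc).mul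
      (ContractiveMultiplier.prod _ fun k _ => hψ k)) ?_
    rw [Complex.norm_real, Real.norm_of_nonneg (by positivity)]
    exact (div_le_one hP).mpr hle
  refine ⟨_, hm.mem_mult, hm.multNorm_le, ?_, fun q hq => ?_⟩
  · simp only [Pi.smul_apply, Pi.mul_apply, Function.comp_apply, smul_eq_mul, Finset.prod_apply,
      hψb, rDisc_fibreFamily, hφp]
    rw [← Complex.ofReal_prod, ← Complex.ofReal_mul, ← Complex.ofReal_mul]
    congr 1
    change δ / P * (ε * P) = ε * δ
    field_simp
  · simp only [Pi.smul_apply, Pi.mul_apply, Function.comp_apply, smul_eq_mul, Finset.prod_apply,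
      rDisc_fibreFamily]
    obtain ⟨n, k⟩ := p
    obtain ⟨m, j⟩ := q
    rcases eq_or_ne m n with rfl | hmn
    · have hjk : j ∈ Finset.univ.erase k :=
        Finset.mem_erase.mpr ⟨fun h => hq (by rw [h]), Finset.mem_univ _⟩
      rw [Finset.prod_eq_zero hjk (hψa j), mul_zero, mul_zero]
    · rw [hφ0 m hmn, zero_mul, mul_zero]

/-! ### Finite measures and the Carleson condition -/

theorem one_div_repKernel_fibreFamily (p : FibreIndex z) :
    1 / (repKernel (DruryArvesonSpace 2) (fibreFamily z s hs p) (fibreFamily z s hs p)).re =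
      1 - ‖(z p.1 : ℂ)‖ := by
  rw [repKernel_druryArveson_self_re, norm_sq_fibreFamily, one_div_one_div]

/-- The mass at `z` against the total mass of its fibre: `√(1 - |z|²) ≤ (3/2)√(1 - |z|)` and `N√(1 -
|z|) ≥ 1/2`, so `12 = (3/2) · 4 · 2`. -/
theorem one_div_repKernel_dirichletHalf_le (z : Disc) :
    1 / (repKernel (WeightedDirichletSpace (1 / 2)) z z).re ≤
      12 * (((fibreNumber z / 4 + 1 : ℕ) : ℝ) * (1 - ‖(z : ℂ)‖)) := by
  have hz := mem_ball_zero_iff.mp z.2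
  have hz0 := norm_nonneg (z : ℂ)
  have hN2 := one_le_two_mul_fibreNumber_mul_sqrt z
  rw [repKernel_dirichletHalf_self_re, one_div_one_div]
  have ha0 : 0 ≤ √(1 - ‖(z : ℂ)‖) := Real.sqrt_nonneg _
  have haa : √(1 - ‖(z : ℂ)‖) ^ 2 = 1 - ‖(z : ℂ)‖ := Real.sq_sqrt (by linarith)
  have h1 : √(1 - ‖(z : ℂ)‖ ^ 2) ≤ 3 / 2 * √(1 - ‖(z : ℂ)‖) := by
    refine Real.sqrt_le_iff.mpr ⟨by positivity, ?_⟩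
    rw [mul_pow, haa]
    nlinarith
  have h2 : (fibreNumber z : ℝ) / 4 ≤ ((fibreNumber z / 4 + 1 : ℕ) : ℝ) := by
    have : fibreNumber z ≤ 4 * (fibreNumber z / 4 + 1) := by omega
    have : (fibreNumber z : ℝ) ≤ 4 * ((fibreNumber z / 4 + 1 : ℕ) : ℝ) := by exact_mod_cast this
    linarith
  have h3 : (fibreNumber z : ℝ) / 4 * √(1 - ‖(z : ℂ)‖) ^ 2 ≤
      ((fibreNumber z / 4 + 1 : ℕ) : ℝ) * √(1 - ‖(z : ℂ)‖) ^ 2 := by gcongr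
  rw [← haa]
  nlinarith

theorem generatesFiniteMeasure_of_fibreFamily
    (h : GeneratesFiniteMeasure (DruryArvesonSpace 2) (fibreFamily z s hs)) :
    GeneratesFiniteMeasure (WeightedDirichletSpace (1 / 2)) z := by
  have h1 := (h.sigma).mul_left 12
  simp only [one_div_repKernel_fibreFamily, tsum_fintype, Finset.sum_const, Finset.card_univ,
    Fintype.card_fin, nsmul_eq_mul] at h1
  refine Summable.of_nonneg_of_le (fun n => ?_)
    (fun n => one_div_repKernel_dirichletHalf_le (z n)) h1
  rw [repKernel_dirichletHalf_self_re, one_div_one_div]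
  positivity

/-- Test the condition on `g = f ∘ r`, which is constant on fibres and satisfies `‖g‖ ≤ ‖f‖`. -/
theorem carlesonCondition_of_fibreFamily
    (h : CarlesonCondition (DruryArvesonSpace 2) (fibreFamily z s hs)) :
    CarlesonCondition (WeightedDirichletSpace (1 / 2)) z := by
  obtain ⟨C, hC, h⟩ := h
  refine ⟨12 * C, by positivity, fun f => ?_⟩
  obtain ⟨g, hg, hgn⟩ := exists_comp_rDisc f
  obtain ⟨h1, h2⟩ := h g
  rw [h1.tsum_sigma] at h2
  have h3 := h1.sigma.mul_left 12
  have e : ∀ n, ∑' k, ‖g (fibreFamily z s hs ⟨n, k⟩)‖ ^ 2 / (repKernel (DruryArvesonSpace 2)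
      (fibreFamily z s hs ⟨n, k⟩) (fibreFamily z s hs ⟨n, k⟩)).re =
      ‖f (z n)‖ ^ 2 * (((fibreNumber (z n) / 4 + 1 : ℕ) : ℝ) * (1 - ‖(z n : ℂ)‖)) := by
    intro n
    rw [tsum_fintype]
    have e1 : ∀ k, ‖g (fibreFamily z s hs ⟨n, k⟩)‖ ^ 2 / (repKernel (DruryArvesonSpace 2)
        (fibreFamily z s hs ⟨n, k⟩) (fibreFamily z s hs ⟨n, k⟩)).re =
        ‖f (z n)‖ ^ 2 * (1 - ‖(z n : ℂ)‖) := fun k => by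
      rw [div_eq_mul_one_div, one_div_repKernel_fibreFamily, hg, rDisc_fibreFamily]
    simp only [e1, Finset.sum_const, Finset.card_univ, Fintype.card_fin, nsmul_eq_mul]
    ring
  have hle : ∀ n, ‖f (z n)‖ ^ 2 / (repKernel (WeightedDirichletSpace (1 / 2)) (z n) (z n)).re ≤
      12 * ∑' k, ‖g (fibreFamily z s hs ⟨n, k⟩)‖ ^ 2 / (repKernel (DruryArvesonSpace 2)
        (fibreFamily z s hs ⟨n, k⟩) (fibreFamily z s hs ⟨n, k⟩)).re := by
    intro n
    rw [e, div_eq_mul_one_div, mul_left_comm]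
    gcongr
    exact one_div_repKernel_dirichletHalf_le (z n)
  have hs' : Summable fun n => ‖f (z n)‖ ^ 2 /
      (repKernel (WeightedDirichletSpace (1 / 2)) (z n) (z n)).re := by
    refine Summable.of_nonneg_of_le (fun n => ?_) hle h3
    rw [repKernel_dirichletHalf_self_re]
    positivity
  refine ⟨hs', (hs'.tsum_le_tsum hle h3).trans ?_⟩
  rw [tsum_mul_left, mul_assoc]
  gcongr
  exact h2.trans (by gcongr)

/-! ### Uniform separation -/

theorem kernelDist_mem_unitInterval {X : Type*} (H : Type*) [NormedAddCommGroup H]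
    [InnerProductSpace ℂ H] [CompleteSpace H] [RKHS ℂ H X ℂ] (x y : X) :
    0 ≤ kernelDist H x y ∧ kernelDist H x y ≤ 1 :=
  ⟨Real.sqrt_nonneg _, Real.sqrt_le_one.mpr (sub_le_self _ (kernelRatio_nonneg H x y))⟩

theorem uniformlySeparated_fibreFamily
    (h : UniformlySeparated (WeightedDirichletSpace (1 / 2)) z) :
    UniformlySeparated (DruryArvesonSpace 2) (fibreFamily z s hs) := by
  classical
  obtain ⟨ε, hε, h⟩ := h
  set a := fun m n => kernelRatio (WeightedDirichletSpace (1 / 2)) (z m) (z n)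
  set b := fun p q => kernelRatio (DruryArvesonSpace 2) (fibreFamily z s hs p)
    (fibreFamily z s hs q) with hb
  have hprod : ∀ n (t : Finset {j // j ≠ n}), ε ≤ ∏ j ∈ t, √(1 - a j n) := fun n =>
    (le_tprod_iff_of_mem_unitInterval (fun j => (kernelDist_mem_unitInterval _ _ _).1)
      fun j => (kernelDist_mem_unitInterval _ _ _).2).mp (h n)
  -- The product bound gives `-2 log ε` for the indices `m ≠ n`; the extra 1 allows `m = n`, which
  -- is the point's own fibre.
  have hsum : ∀ n (t : Finset ℕ), ∑ m ∈ t, a m n ≤ 1 - 2 * Real.log ε := by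
    intro n t
    have h1 := sum_le_log_of_le_prod_sqrt (t.subtype (· ≠ n)) hε (hprod n _)
    rw [Finset.sum_subtype_eq_sum_filter (f := fun m => a m n)] at h1
    rw [← Finset.sum_filter_add_sum_filter_not t (· ≠ n)]
    have h2 : ∑ m ∈ t with ¬ m ≠ n, a m n ≤ 1 := by
      refine (Finset.sum_le_sum_of_subset_of_nonneg (t := {n}) ?_
        fun _ _ _ => kernelRatio_nonneg _ _ _).trans ?_
      · intro m hm
        simpa using (Finset.mem_filter.mp hm).2
      · rw [Finset.sum_singleton]
        exact kernelRatio_le_one _ _ _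
    linarith
  have hsq : ∀ m n, m ≠ n → a m n ≤ 1 - ε ^ 2 := by
    intro m n hmn
    have h1 := hprod n {⟨m, hmn⟩}
    rw [Finset.prod_singleton] at h1
    have h2 : ε ^ 2 ≤ 1 - a m n := (Real.le_sqrt' hε).mp h1
    linarith
  -- `ε²` serves pairs in different fibres, `3/4` pairs in the same fibre.
  set η := min (ε ^ 2) (3 / 4)
  have hη : 0 < η := by positivity
  refine ⟨Real.exp (-(200000 * (1 - 2 * Real.log ε) / η)), Real.exp_pos _, fun q => ?_⟩
  refine (le_tprod_iff_of_mem_unitInterval (fun j => (kernelDist_mem_unitInterval _ _ _).1)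
      fun j => (kernelDist_mem_unitInterval _ _ _).2).mpr fun t => ?_
  refine exp_neg_le_prod_sqrt t (b := fun p => b p q) hη (fun p _ => kernelRatio_nonneg _ _ _)
    (fun p _ => ?_) ?_
  · obtain ⟨⟨m, k⟩, hp⟩ := p
    obtain ⟨n, j⟩ := q
    rcases eq_or_ne m n with rfl | hmn
    · have hkj : k ≠ j := fun h => hp (by rw [h])
      have h1 := kernelRatio_same_fibre_le z s hs hkj
      have h2 : η ≤ 3 / 4 := min_le_right _ _
      exact h1.trans (by linarith)
    · have h1 := kernelRatio_druryArveson_le (fibreFamily z s hs ⟨m, k⟩)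
        (fibreFamily z s hs ⟨n, j⟩)
      rw [rDisc_fibreFamily, rDisc_fibreFamily] at h1
      have h2 : η ≤ ε ^ 2 := min_le_left _ _
      exact (h1.trans (hsq m n hmn)).trans (by linarith)
  -- Enlarge the finite set to a union of complete fibres, then sum fibre by fibre.
  · set T : Finset (FibreIndex z) := t.map (Function.Embedding.subtype _) with hT
    have e : ∑ p ∈ t, b p q = ∑ p ∈ T, b p q := by rw [hT, Finset.sum_map]; rfl
    have hsub : T ⊆ (T.image Sigma.fst).sigma fun _ => Finset.univ := fun p hp =>
      Finset.mem_sigma.mpr ⟨Finset.mem_image_of_mem _ hp, Finset.mem_univ _⟩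
    calc ∑ p ∈ t, b p q = ∑ p ∈ T, b p q := e
      _ ≤ ∑ p ∈ (T.image Sigma.fst).sigma fun _ => Finset.univ, b p q :=
          Finset.sum_le_sum_of_subset_of_nonneg hsub fun _ _ _ => kernelRatio_nonneg _ _ _
      _ = ∑ m ∈ T.image Sigma.fst, ∑ k, b ⟨m, k⟩ q := Finset.sum_sigma _ _ _
      _ ≤ ∑ m ∈ T.image Sigma.fst, 200000 * a m q.1 :=
          Finset.sum_le_sum fun m _ => sum_kernelRatio_fibre_le z s hs m q
      _ ≤ 200000 * (1 - 2 * Real.log ε) := by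
          rw [← Finset.mul_sum]
          exact mul_le_mul_of_nonneg_left (hsum _ _) (by norm_num)

end FibreFamily

end

theorem mainTheorem6 (z : ℕ → Disc) (s : ℕ → ℂ) (hs : ∀ n, s n ^ 2 = (z n : ℂ)) :
    (∀ p, rMap (fibreFamily z s hs p) = z p.1) ∧
    (Function.Injective z → Function.Injective (fibreFamily z s hs)) ∧
    (StronglySeparated (WeightedDirichletSpace (1 / 2)) z →
      StronglySeparated (DruryArvesonSpace 2) (fibreFamily z s hs)) ∧
    (¬ GeneratesFiniteMeasure (WeightedDirichletSpace (1 / 2)) z →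
      ¬ GeneratesFiniteMeasure (DruryArvesonSpace 2) (fibreFamily z s hs)) ∧
    (¬ CarlesonCondition (WeightedDirichletSpace (1 / 2)) z →
      ¬ CarlesonCondition (DruryArvesonSpace 2) (fibreFamily z s hs)) ∧
    (UniformlySeparated (WeightedDirichletSpace (1 / 2)) z →
      UniformlySeparated (DruryArvesonSpace 2) (fibreFamily z s hs)) :=
  ⟨rMap_fibreFamily z s hs, fibreFamily_injective z s hs, stronglySeparated_fibreFamily z s hs,
    mt (generatesFiniteMeasure_of_fibreFamily z s hs),
    mt (carlesonCondition_of_fibreFamily z s hs), uniformlySeparated_fibreFamily z s hs⟩
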